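/- **Setting.** Hyperbolic 3-space is $\mathbb{H}^3$, with upper half space model $\{(x,y,z): z>0\}$, boundary $\mathbb{C}\cup\{\infty\}$, $\mathbb{C}$ being the $xy$-plane. In the hyperboloid model, $\mathbb{R}^{1,3}$ is identified with Hermitian $2\times2$ matrices by $(T,X,Y,Z)\mapsto\frac12\begin{pmatrix}T+Z&X+iY\\X-iY&T-Z\end{pmatrix}$, $SL(2,\mathbb{C})$ acts by $S\mapsto ASA^*$, and the point $p$ of the positive light cone defines the horosphere $\{q:\langle q,p\rangle=1\}$, centred at the ray of $p$, i.e. at $(X+iY)/(T-Z)\in\mathbb{C}\cup\{\infty\}$. A *decoration* on a horosphere $\mathfrak h$ is a parallel unit tangent vector field $V$ on it (equivalently a parallel oriented line field). With $N^{in},N^{out}$ the unit normals pointing away from and towards the centre, $V$ gives the frame fields $(N^{in},V,N^{in}\times V)$ and $(N^{out},V,N^{out}\times V)$. A *spin decoration* $W=(W^{in},W^{out})$ is a pair of continuous lifts of these two frame fields to the spin double cover of the bundle of right-handed orthonormal frames, such that $W^{in}$ is $W^{out}$ rotated by $\pi$ about $V$ and $W^{out}$ is $W^{in}$ rotated by $-\pi$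 about $V$. Spin frames are identified with $SL(2,\mathbb{C})$, the identity lying over the frame $(e_z,e_y,-e_x)$ at $(0,0,1)$, and $A$ over its image under $A$. *Spinors.* To each $\kappa=(\xi,\eta)\in\mathbb{C}^2\setminus\{0\}$ corresponds the spin-decorated horosphere $\widetilde{\mathbf K}(\kappa)$ whose horosphere is that of the point $\kappa\kappa^*$ of the light cone, whose decoration points along the flag of $\kappa$ (i.e. lies in the half plane $\mathbb{R}\,\kappa\kappa^*+\mathbb{R}_{>0}(\kappa Z^*+Z\kappa^*)$, $Z=(i\bar\eta,-i\bar\xi)$), and whose outward spin decoration is the set of all $A\in SL(2,\mathbb{C})$ with first column $\kappa$ (the continuous $SL(2,\mathbb{C})$-equivariant lift). We say that $\kappa$ is the spin vector of $\widetilde{\mathbf K}(\kappa)$. *The plane.* $\mathbb{H}^2$ is the half plane $y=0$, with $\partial\mathbb{H}^2=\mathbb{R}\cup\{\infty\}$ oriented along $\mathbb{R}$ in the negative direction. A horocycle of $\mathbb{H}^2$ extends to a unique horosphere of $\mathbb{H}^3$; a *planar spin decoration* on the horocycle is a spin decoration on this horosphere whose decoration is specified by $i$, i.e. points in the direction $e_y$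 at the north pole of the horosphere (at every point, if the centre is $\infty$). *Polygons.* A *generalised ideal $d$-gon* is a $d$-tuple of points of $\partial\mathbb{H}^2$; it is *degenerate* if all its vertices coincide. It is an *ideal $d$-gon* if the vertices are distinct and labelled in cyclic order around the oriented circle $\partial\mathbb{H}^2$. A *generalised ideal $d$-gon with planar spin decorations* carries at each vertex $z_i$ a horocycle $\mathfrak h_i$ centred at $z_i$ with a planar spin decoration $W_i$. For distinct centres, the *complex distance* $d_{ij}=\rho_{ij}+i\theta_{ij}$ (modulo $4\pi i$) is such that translation by $\rho_{ij}$ along the geodesic from $z_i$ to $z_j$ followed by rotation by $\theta_{ij}$ about it takes $W_i^{in}$ to $W_j^{out}$, these spin frames being taken where the geodesic meets $\mathfrak h_i$ and $\mathfrak h_j$; the *lambda length* is $\lambda_{ij}=e^{d_{ij}/2}$. The decorations are *spin-coherent* if the vertices are distinct, $\lambda_{ij}>0$ for $i<j$ and $\lambda_{ij}<0$ for $i>j$. **Statement.** Let $d\ge0$. For every generalised ideal $d$-gon with planar spin decorations, each decorated vertex has exactly one spin vector $\kappa_i$, and $\kappa_i\in\mathbb{R}^2$. The map which sends the polygon to the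 real matrix with columns $\kappa_1,\dots,\kappa_d$ is 1. a bijection from the generalised ideal $d$-gons with planar spin decorations onto the $2\times d$ real matrices with no zero column; 2. restricts to a bijection from the nondegenerate generalised ideal $d$-gons with planar spin decorations onto the $2\times d$ real matrices of rank $2$ with no zero column; 3. if $d\ge2$, restricts to a bijection from the ideal $d$-gons with spin-coherent planar spin decorations onto the $2\times d$ real matrices all of whose $2\times2$ minors (with columns $i<j$, in this order) are positive. -/

import Mathlib

open Matrix OnePoint
open scoped ComplexConjugate

namespace SpinHyp

noncomputable section

/-! ### Minkowski space, Hermitian matrices and the action of `SL(2,ℂ)` -/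

/-- Minkowski space `ℝ^{1,3}`, with coordinates `(T, X, Y, Z) = (x 0, x 1, x 2, x 3)`. -/
abbrev Minkowski : Type := Fin 4 → ℝ

/-- The Lorentzian inner product `TT' - XX' - YY' - ZZ'`. -/
def minkInner (x y : Minkowski) : ℝ := x 0 * y 0 - x 1 * y 1 - x 2 * y 2 - x 3 * y 3

/-- The group `SL(2,ℂ)`. -/
abbrev SL2C : Type := Matrix.SpecialLinearGroup (Fin 2) ℂ

/-- The linear isomorphism from Minkowski space to Hermitian `2 × 2` matrices,
`(T,X,Y,Z) ↦ (1/2) [[T+Z, X+iY], [X-iY, T-Z]]`. -/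
def toHermitian (x : Minkowski) : Matrix (Fin 2) (Fin 2) ℂ :=
  !![((x 0 : ℂ) + x 3) / 2, ((x 1 : ℂ) + Complex.I * x 2) / 2;
     ((x 1 : ℂ) - Complex.I * x 2) / 2, ((x 0 : ℂ) - x 3) / 2]

/-- The inverse isomorphism, `[[a, b+ci], [b-ci, d]] ↦ (a+d, 2b, 2c, a-d)` on Hermitian matrices. -/
def ofHermitian (S : Matrix (Fin 2) (Fin 2) ℂ) : Minkowski :=
  ![(S 0 0).re + (S 1 1).re, 2 * (S 0 1).re, 2 * (S 0 1).im, (S 0 0).re - (S 1 1).re]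

/-- The action of `SL(2,ℂ)` on Minkowski space, induced by `S ↦ A S A*` on Hermitian matrices. -/
def act (A : SL2C) (x : Minkowski) : Minkowski :=
  ofHermitian ((A : Matrix (Fin 2) (Fin 2) ℂ) * toHermitian x * (A : Matrix (Fin 2) (Fin 2) ℂ)ᴴ)

/-- The hyperboloid model of hyperbolic 3-space. The tangent space at `q` is `q^⊥`, with the
Riemannian metric given by minus the Lorentzian inner product. -/
def hyperboloid : Set Minkowski := {q | 0 < q 0 ∧ minkInner q q = 1}

/-- The positive light cone; its rays are the points of the sphere at infinity. -/
def lightCone : Set Minkowski := {p | 0 < p 0 ∧ minkInner p p = 0}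

/-- The cross product of vectors `u, v` tangent to the hyperboloid at `q`: the tangent vector `w`
with `-⟨w, x⟩ = det (q, u, v, x)` for all `x`. At `(1,0,0,0)` it is the usual right-handed cross
product in the coordinates `X, Y, Z`. -/
def cross (q u v : Minkowski) : Minkowski :=
  ![-(Matrix.of ![q, u, v, ![1, 0, 0, 0]]).det, (Matrix.of ![q, u, v, ![0, 1, 0, 0]]).det,
    (Matrix.of ![q, u, v, ![0, 0, 1, 0]]).det, (Matrix.of ![q, u, v, ![0, 0, 0, 1]]).det]

/-! ### Frames and spin frames -/

/-- A triple of vectors at a point. All the triples used below are right-handed orthonormal frames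
of hyperbolic space. -/
@[ext] structure Frame where
  pos : Minkowski
  v1 : Minkowski
  v2 : Minkowski
  v3 : Minkowski

/-- Rotation by the angle `θ` about the first vector (right-handed). -/
def Frame.rotateFirst (θ : ℝ) (F : Frame) : Frame where
  pos := F.pos
  v1 := F.v1
  v2 := Real.cos θ • F.v2 + Real.sin θ • F.v3
  v3 := -Real.sin θ • F.v2 + Real.cos θ • F.v3

/-- Rotation by the angle `θ` about the second vector (right-handed). -/
def Frame.rotateSecond (θ : ℝ) (F : Frame) : Frame where
  pos := F.pos
  v1 := Real.cos θ • F.v1 - Real.sin θ • F.v3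
  v2 := F.v2
  v3 := Real.sin θ • F.v1 + Real.cos θ • F.v3

/-- Parallel translation by the signed distance `ρ` along the oriented geodesic through the
basepoint which is directed by the first vector. -/
def Frame.translate (ρ : ℝ) (F : Frame) : Frame where
  pos := Real.cosh ρ • F.pos + Real.sinh ρ • F.v1
  v1 := Real.sinh ρ • F.pos + Real.cosh ρ • F.v1
  v2 := F.v2
  v3 := F.v3

/-- The double cover `Spin → Fr` of the bundle of right-handed orthonormal frames. `SL(2,ℂ)` acts
simply transitively on spin frames, so the total space of `Spin` is `SL(2,ℂ)`; the spin frame `A`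
lies over the image under the isometry `A` of the base frame `(∂_Z, ∂_Y, -∂_X)` at `(1,0,0,0)`
(in the upper half space model, the frame `(e_z, e_y, -e_x)` at `(0,0,1)`). -/
def spinProj (A : SL2C) : Frame where
  pos := act A ![1, 0, 0, 0]
  v1 := act A ![0, 0, 0, 1]
  v2 := act A ![0, 0, 1, 0]
  v3 := act A ![0, -1, 0, 0]

/-- The spin frame `s'` is obtained from the spin frame `s` by following the path of frames
`F t`, `0 ≤ t ≤ 1`: the lift of this path to spin frames which starts at `s` ends at `s'`. -/
def SpinTransport (F : ℝ → Frame) (s s' : SL2C) : Prop :=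
  ∃ γ : ℝ → SL2C, Continuous γ ∧ (∀ t, spinProj (γ t) = F t) ∧ γ 0 = s ∧ γ 1 = s'

/-- Rotating the spin frame `s` by the angle `θ` about the first vector of its frame gives `s'`. -/
def SpinRotateFirst (θ : ℝ) (s s' : SL2C) : Prop :=
  SpinTransport (fun t => (spinProj s).rotateFirst (t * θ)) s s'

/-- Rotating the spin frame `s` by the angle `θ` about the second vector of its frame gives `s'`. -/
def SpinRotateSecond (θ : ℝ) (s s' : SL2C) : Prop :=
  SpinTransport (fun t => (spinProj s).rotateSecond (t * θ)) s s'

/-- Translating the spin frame `s` by the signed distance `ρ` along the geodesic directed by the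
first vector of its frame gives `s'`. -/
def SpinTranslate (ρ : ℝ) (s s' : SL2C) : Prop :=
  SpinTransport (fun t => (spinProj s).translate (t * ρ)) s s'

/-! ### Horospheres, decorations and spin decorations -/

/-- The horosphere cut out of the hyperboloid by the lightlike 3-plane `⟨q, p⟩ = 1`. -/
def horosphereOf (p : Minkowski) : Set Minkowski := {q | q ∈ hyperboloid ∧ minkInner q p = 1}

/-- A horosphere in hyperbolic 3-space. -/
structure Horosphere where
  carrier : Set Minkowski
  exists_normal : ∃ p ∈ lightCone, carrier = horosphereOf p

/-- The point of the light cone defining a horosphere (it is unique). -/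
def Horosphere.normal (h : Horosphere) : Minkowski := h.exists_normal.choose

/-- The centre of the horosphere, the point at infinity given by the ray through its normal, as a
point of `ℂ ∪ {∞}`, the boundary of the upper half space model. -/
def Horosphere.centre (h : Horosphere) : OnePoint ℂ :=
  open Classical in
  if h.normal 0 = h.normal 3 then ∞
  else (((h.normal 1 + Complex.I * h.normal 2) / (h.normal 0 - h.normal 3) : ℂ) : OnePoint ℂ)

/-- The outward unit normal (towards the centre) to a horosphere at its point `q`. -/
def Horosphere.outNormal (h : Horosphere) (q : h.carrier) : Minkowski := h.normal - q

/-- The inward unit normal (away from the centre) to a horosphere at its point `q`. -/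
def Horosphere.inNormal (h : Horosphere) (q : h.carrier) : Minkowski := q - h.normal

/-- The parabolic elements of `SL(2,ℂ)` (including `±1`). -/
def IsParabolic (A : SL2C) : Prop :=
  (A : Matrix (Fin 2) (Fin 2) ℂ).trace = 2 ∨ (A : Matrix (Fin 2) (Fin 2) ℂ).trace = -2

/-- `V` is a unit parallel tangent vector field on the horosphere: it is invariant under the
parabolic isometries which preserve the horosphere. -/
structure Horosphere.IsUnitParallel (h : Horosphere) (V : h.carrier → Minkowski) : Prop where
  tangent_hyperboloid : ∀ q, minkInner (V q) q = 0
  tangent_horosphere : ∀ q, minkInner (V q) h.normal = 0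
  unit : ∀ q, -minkInner (V q) (V q) = 1
  parallel : ∀ A : SL2C, IsParabolic A → act A '' h.carrier = h.carrier →
    ∀ q q' : h.carrier, (q' : Minkowski) = act A q → V q' = act A (V q)

/-- The outward frame field `(N^out, V, N^out × V)`. -/
def Horosphere.outFrame (h : Horosphere) (V : h.carrier → Minkowski) (q : h.carrier) : Frame where
  pos := q
  v1 := h.outNormal q
  v2 := V q
  v3 := cross q (h.outNormal q) (V q)

/-- The inward frame field `(N^in, V, N^in × V)`. -/
def Horosphere.inFrame (h : Horosphere) (V : h.carrier → Minkowski) (q : h.carrier) : Frame where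
  pos := q
  v1 := h.inNormal q
  v2 := V q
  v3 := cross q (h.inNormal q) (V q)

/-- A spin-decorated horosphere: a horosphere with a pair of an inward and an outward spin
decoration (continuous lifts to spin frames of the inward and outward frame fields of a unit
parallel vector field `V`) associated to each other: `W^in` is `W^out` rotated by `π` about `V`,
and `W^out` is `W^in` rotated by `-π` about `V`. -/
structure SpinDecoratedHorosphere extends Horosphere where
  win : carrier → SL2C
  wout : carrier → SL2C
  continuous_win : Continuous win
  continuous_wout : Continuous wout
  associated : ∃ V : carrier → Minkowski, toHorosphere.IsUnitParallel V ∧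
    (∀ q, spinProj (win q) = toHorosphere.inFrame V q) ∧
    (∀ q, spinProj (wout q) = toHorosphere.outFrame V q) ∧
    (∀ q, SpinRotateSecond Real.pi (wout q) (win q)) ∧
    (∀ q, SpinRotateSecond (-Real.pi) (win q) (wout q))

/-- The decoration underlying a spin decoration: the unit parallel vector field `V` such that
`W^in`, `W^out` lift the frame fields of `V`. -/
def SpinDecoratedHorosphere.direction (w : SpinDecoratedHorosphere) (q : w.carrier) : Minkowski :=
  (spinProj (w.wout q)).v2

/-! ### Planar spin decorations -/

/-- The isometry from the hyperboloid model to the upper half space model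
`{(z, t) : z ∈ ℂ, t > 0}`. It maps the points with `Y = 0` to the half plane over `ℝ`. -/
def toUpper (x : Minkowski) : ℂ × ℝ :=
  (((x 1 : ℂ) + Complex.I * x 2) / ((x 0 : ℂ) - x 3), 1 / (x 0 - x 3))

/-- The vector field `V` on the horosphere is specified by the complex number `α`: in the upper
half space model, at every highest point of the horosphere (the north pole if the horosphere is a
sphere, every point if it is a horizontal plane), `V` points in the horizontal direction `α`. -/
def Horosphere.IsSpecifiedBy (h : Horosphere) (V : h.carrier → Minkowski) (α : ℂ) : Prop :=
  ∀ q : h.carrier, (∀ q' : h.carrier, (toUpper q').2 ≤ (toUpper q).2) →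
    ∃ c : ℝ, 0 < c ∧ fderiv ℝ toUpper q (V q) = ((c : ℂ) * α, 0)

/-- A planar spin decoration on the horocycle centred at `z ∈ ∂ℍ² = ℝ ∪ {∞}` in which the
horosphere meets `ℍ²` (the upper half plane over `ℝ` in upper half space; a horocycle of `ℍ²`
extends to a unique horosphere of `ℍ³`, which has the same centre): a spin decoration on the
horosphere whose frames are specified by `i`. -/
def SpinDecoratedHorosphere.IsPlanarAt (w : SpinDecoratedHorosphere) (z : OnePoint ℝ) : Prop :=
  w.centre = z.map ((↑) : ℝ → ℂ) ∧ w.toHorosphere.IsSpecifiedBy w.direction Complex.I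

/-! ### Complex lambda lengths -/

/-- `d = ρ + iθ` is a complex distance from the spin frame `s₁` to the spin frame `s₂`: translation
by `ρ` along the oriented geodesic directed by the first vector of the frame, and then rotation by
`θ` about this geodesic, takes `s₁` to `s₂`. -/
def IsComplexDistance (s₁ s₂ : SL2C) (d : ℂ) : Prop :=
  ∃ s : SL2C, SpinTranslate d.re s₁ s ∧ SpinRotateFirst d.im s s₂

/-- The geodesic of hyperbolic space joining the points at infinity given by `p₁, p₂` on the light
cone. -/
def geodesic (p₁ p₂ : Minkowski) : Set Minkowski :=
  {q | q ∈ hyperboloid ∧ ∃ a b : ℝ, 0 < a ∧ 0 < b ∧ q = a • p₁ + b • p₂}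

/-- `l` is the complex lambda length from `w₁` to `w₂`: it is `0` if the centres agree, and
otherwise `exp (d/2)`, where `d` is a complex distance from `W₁^in(q₁)` to `W₂^out(q₂)` and `q₁, q₂`
are the points where the geodesic joining the centres meets the horospheres. -/
def IsLambdaLength (w₁ w₂ : SpinDecoratedHorosphere) (l : ℂ) : Prop :=
  (w₁.centre = w₂.centre ∧ l = 0) ∨
  (w₁.centre ≠ w₂.centre ∧ ∃ (q₁ : w₁.carrier) (q₂ : w₂.carrier) (d : ℂ),
    (q₁ : Minkowski) ∈ geodesic w₁.normal w₂.normal ∧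
    (q₂ : Minkowski) ∈ geodesic w₁.normal w₂.normal ∧
    IsComplexDistance (w₁.win q₁) (w₂.wout q₂) d ∧ l = Complex.exp (d / 2))

/-! ### Ideal polygons -/

/-- A generalised ideal `d`-gon in the hyperbolic plane (an arbitrary `d`-tuple of points of
`∂ℍ² = ℝ ∪ {∞}`) with a horocycle and a planar spin decoration at each vertex. -/
structure DecoratedPolygon (d : ℕ) where
  vertex : Fin d → OnePoint ℝ
  dec : Fin d → SpinDecoratedHorosphere
  planar : ∀ i, (dec i).IsPlanarAt (vertex i)

/-- A generalised ideal polygon is degenerate if all its vertices coincide. -/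
def DecoratedPolygon.IsDegenerate {d : ℕ} (P : DecoratedPolygon d) : Prop :=
  ∀ i j, P.vertex i = P.vertex j

/-- The points of `ℝ ∪ {∞}`, cut open at `∞`, as a linear order in which `∞` is greatest. -/
def cut (z : OnePoint ℝ) : WithTop ℝ := z.elim ⊤ (fun x => (x : WithTop ℝ))

/-- The points `z_0, …, z_{d-1}` are distinct and lie in cyclic order around the circle
`ℝ ∪ {∞}`, oriented along `ℝ` in the negative direction. -/
def InOrder {d : ℕ} (z : Fin d → OnePoint ℝ) : Prop :=
  Function.Injective z ∧ ∀ i j k, i < j → j < k →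
    (cut (z i) > cut (z j) ∧ cut (z j) > cut (z k)) ∨
    (cut (z j) > cut (z k) ∧ cut (z k) > cut (z i)) ∨
    (cut (z k) > cut (z i) ∧ cut (z i) > cut (z j))

/-- The underlying generalised ideal polygon is an ideal polygon. -/
def DecoratedPolygon.IsIdealPolygon {d : ℕ} (P : DecoratedPolygon d) : Prop := InOrder P.vertex

/-- The planar spin decorations are spin-coherent: the centres are distinct, and the lambda length
`λ_ij` is positive for `i < j` and negative for `i > j`. -/
def DecoratedPolygon.IsSpinCoherent {d : ℕ} (P : DecoratedPolygon d) : Prop :=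
  Function.Injective P.vertex ∧ ∀ i j,
    (i < j → ∃ l : ℝ, 0 < l ∧ IsLambdaLength (P.dec i) (P.dec j) l) ∧
    (j < i → ∃ l : ℝ, l < 0 ∧ IsLambdaLength (P.dec i) (P.dec j) l)

/-! ### The spinor–horosphere correspondence -/

theorem toHermitian_ofHermitian {S : Matrix (Fin 2) (Fin 2) ℂ} (hS : Sᴴ = S) :
    toHermitian (ofHermitian S) = S := by
  have h00 := congrFun (congrFun hS 0) 0
  have h01 := congrFun (congrFun hS 0) 1
  have h10 := congrFun (congrFun hS 1) 0
  have h11 := congrFun (congrFun hS 1) 1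
  simp only [conjTranspose_apply, Complex.ext_iff, Complex.star_def, Complex.conj_re,
    Complex.conj_im] at h00 h01 h10 h11
  ext i j
  fin_cases i <;> fin_cases j <;>
    simp [toHermitian, ofHermitian, Complex.ext_iff] <;>
    (try constructor) <;> linarith [h00.2, h01.1, h01.2, h10.1, h10.2, h11.2]

theorem ofHermitian_toHermitian (x : Minkowski) : ofHermitian (toHermitian x) = x := by
  ext i
  fin_cases i <;> simp [toHermitian, ofHermitian] <;> ring

theorem toHermitian_conjTranspose (x : Minkowski) : (toHermitian x)ᴴ = toHermitian x := by
  ext i j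
  fin_cases i <;> fin_cases j <;> simp [toHermitian, Complex.ext_iff]

theorem toHermitian_act (A : SL2C) (x : Minkowski) :
    toHermitian (act A x) = (A : Matrix (Fin 2) (Fin 2) ℂ) * toHermitian x *
      (A : Matrix (Fin 2) (Fin 2) ℂ)ᴴ := by
  apply toHermitian_ofHermitian
  simp [Matrix.conjTranspose_mul, toHermitian_conjTranspose, Matrix.mul_assoc]

theorem toHermitian_injective : Function.Injective toHermitian :=
  Function.LeftInverse.injective ofHermitian_toHermitian

theorem act_mul (A B : SL2C) (x : Minkowski) : act (A * B) x = act A (act B x) := by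
  apply toHermitian_injective
  simp [toHermitian_act, Matrix.conjTranspose_mul, Matrix.mul_assoc]

theorem act_neg (A : SL2C) (x : Minkowski) : act (-A) x = act A x := by
  apply toHermitian_injective
  simp [toHermitian_act]

theorem act_one (x : Minkowski) : act 1 x = x := by
  apply toHermitian_injective
  simp [toHermitian_act]

theorem toHermitian_add (x y : Minkowski) :
    toHermitian (x + y) = toHermitian x + toHermitian y := by
  ext i j
  fin_cases i <;> fin_cases j <;> simp [toHermitian] <;> ring

theorem toHermitian_smul (c : ℝ) (x : Minkowski) :
    toHermitian (c • x) = (c : ℂ) • toHermitian x := by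
  ext i j
  fin_cases i <;> fin_cases j <;> simp [toHermitian] <;> ring

theorem act_add (A : SL2C) (x y : Minkowski) : act A (x + y) = act A x + act A y := by
  apply toHermitian_injective
  simp [toHermitian_act, toHermitian_add, Matrix.mul_add, Matrix.add_mul]

theorem act_smul (A : SL2C) (c : ℝ) (x : Minkowski) : act A (c • x) = c • act A x := by
  apply toHermitian_injective
  simp [toHermitian_act, toHermitian_smul]

theorem minkInner_self (x : Minkowski) : (minkInner x x : ℂ) = 4 * (toHermitian x).det := by
  simp only [minkInner, toHermitian, det_fin_two_of]
  push_cast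
  linear_combination -((x 2 : ℂ) ^ 2) * Complex.I_sq

theorem minkInner_act_self (A : SL2C) (x : Minkowski) :
    minkInner (act A x) (act A x) = minkInner x x := by
  have h : (minkInner (act A x) (act A x) : ℂ) = minkInner x x := by
    rw [minkInner_self, minkInner_self, toHermitian_act]
    simp [det_conjTranspose]
  exact_mod_cast h

theorem minkInner_act (A : SL2C) (x y : Minkowski) :
    minkInner (act A x) (act A y) = minkInner x y := by
  have h1 := minkInner_act_self A (x + y)
  have h2 := minkInner_act_self A x
  have h3 := minkInner_act_self A y
  rw [act_add] at h1
  simp only [minkInner, Pi.add_apply] at h1 h2 h3 ⊢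
  linarith

/-- The matrix of the rotation by `θ` about the second vector of the base frame. -/
def rotMatrix (θ : ℝ) : SL2C :=
  ⟨!![(Real.cos (θ / 2) : ℂ), -Real.sin (θ / 2); Real.sin (θ / 2), Real.cos (θ / 2)], by
    rw [det_fin_two_of]
    have := Real.sin_sq_add_cos_sq (θ / 2)
    norm_cast
    linarith⟩

theorem act_rotMatrix (θ : ℝ) (x : Minkowski) : act (rotMatrix θ) x =
    ![x 0, Real.cos θ * x 1 + Real.sin θ * x 3, x 2, Real.cos θ * x 3 - Real.sin θ * x 1] := by
  have hs : Real.sin θ = 2 * Real.sin (θ / 2) * Real.cos (θ / 2) := by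
    rw [← Real.sin_two_mul]; congr 1; ring
  have hc : Real.cos θ = Real.cos (θ / 2) ^ 2 - Real.sin (θ / 2) ^ 2 := by
    rw [← Real.cos_two_mul']; congr 1; ring
  have h1 := Real.sin_sq_add_cos_sq (θ / 2)
  have h2 : (Complex.sin ((θ : ℂ) / 2)) = ((Real.sin (θ / 2) : ℝ) : ℂ) := by push_cast; rfl
  have h3 : (Complex.cos ((θ : ℂ) / 2)) = ((Real.cos (θ / 2) : ℝ) : ℂ) := by push_cast; rfl
  rw [hs, hc]
  simp only [act, rotMatrix]
  generalize Real.sin (θ / 2) = s at *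
  generalize Real.cos (θ / 2) = c at *
  ext i
  fin_cases i <;>
    simp [ofHermitian, toHermitian, Matrix.mul_apply, Fin.sum_univ_two]
  · linear_combination (x 0) * h1
  · ring
  · linear_combination (x 2) * h1
  · ring

theorem spinProj_mul_rotMatrix (A : SL2C) (θ : ℝ) :
    spinProj (A * rotMatrix θ) = (spinProj A).rotateSecond θ := by
  have e (x y z : Minkowski) (a b : ℝ) (h : x = a • y + b • z) :
      act A x = a • act A y + b • act A z := by rw [h, act_add, act_smul, act_smul]
  ext1 <;> simp only [spinProj, Frame.rotateSecond, act_mul, act_rotMatrix]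
  · congr 1; ext i; fin_cases i <;> simp
  · have h := e ![0, Real.sin θ, 0, Real.cos θ] ![0, 0, 0, 1] ![0, -1, 0, 0]
      (Real.cos θ) (-Real.sin θ) (by ext i; fin_cases i <;> simp)
    rw [neg_smul, ← sub_eq_add_neg] at h
    rw [← h]
    congr 1; ext i; fin_cases i <;> simp
  · congr 1; ext i; fin_cases i <;> simp
  · apply e; ext i; fin_cases i <;> simp

theorem rotMatrix_zero : rotMatrix 0 = 1 := by
  ext i j; fin_cases i <;> fin_cases j <;> simp [rotMatrix]

theorem rotMatrix_pi_mul_neg_pi : rotMatrix Real.pi * rotMatrix (-Real.pi) = 1 := by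
  have h : Complex.sin (-(Real.pi : ℂ) / 2) = -1 := by
    rw [neg_div, Complex.sin_neg, Complex.sin_pi_div_two]
  have h' : Complex.cos (-(Real.pi : ℂ) / 2) = 0 := by
    rw [neg_div, Complex.cos_neg, Complex.cos_pi_div_two]
  apply Subtype.ext
  rw [Matrix.SpecialLinearGroup.coe_mul]
  ext i j; fin_cases i <;> fin_cases j <;>
    simp [rotMatrix, Matrix.mul_apply, Fin.sum_univ_two, h, h']

theorem continuous_rotMatrix : Continuous rotMatrix := by
  refine Continuous.subtype_mk (continuous_matrix fun i j => ?_) _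
  fin_cases i <;> fin_cases j <;> simp <;> fun_prop

theorem spinRotateSecond_mul (A : SL2C) (θ : ℝ) : SpinRotateSecond θ A (A * rotMatrix θ) :=
  ⟨fun t => A * rotMatrix (t * θ),
    continuous_const.mul (continuous_rotMatrix.comp (continuous_mul_const θ)),
    fun t => spinProj_mul_rotMatrix A (t * θ), by simp [rotMatrix_zero], by simp⟩

theorem cross_apply (q u v : Minkowski) : cross q u v =
    ![(q 1 * (u 2 * v 3 - u 3 * v 2) - q 2 * (u 1 * v 3 - u 3 * v 1) + q 3 * (u 1 * v 2 - u 2 * v 1)),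
      (q 0 * (u 2 * v 3 - u 3 * v 2) - q 2 * (u 0 * v 3 - u 3 * v 0) + q 3 * (u 0 * v 2 - u 2 * v 0)),
      -(q 0 * (u 1 * v 3 - u 3 * v 1) - q 1 * (u 0 * v 3 - u 3 * v 0) + q 3 * (u 0 * v 1 - u 1 * v 0)),
      (q 0 * (u 1 * v 2 - u 2 * v 1) - q 1 * (u 0 * v 2 - u 2 * v 0) + q 2 * (u 0 * v 1 - u 1 * v 0))] := by
  ext i
  fin_cases i <;>
    simp [cross, det_succ_row_zero, Fin.sum_univ_succ, Fin.succAbove] <;> ring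

theorem spinProj_v3 (A : SL2C) :
    (spinProj A).v3 = cross (spinProj A).pos (spinProj A).v1 (spinProj A).v2 := by
  obtain ⟨M, hM⟩ := A
  have hd := hM
  rw [det_fin_two, Complex.ext_iff] at hd
  simp only [Complex.sub_re, Complex.sub_im, Complex.mul_re, Complex.mul_im, Complex.one_re,
    Complex.one_im] at hd
  obtain ⟨hr, hi⟩ := hd
  simp only [spinProj, act, cross_apply]
  have e0 : M 0 0 = ⟨(M 0 0).re, (M 0 0).im⟩ := rfl
  clear hM
  simp only [ofHermitian, Matrix.mul_apply, Fin.sum_univ_two, conjTranspose_apply, toHermitian]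
  generalize M 0 0 = a at *
  generalize M 0 1 = b at *
  generalize M 1 0 = c at *
  generalize M 1 1 = d at *
  obtain ⟨a, a'⟩ := a
  obtain ⟨b, b'⟩ := b
  obtain ⟨c, c'⟩ := c
  obtain ⟨d, d'⟩ := d
  simp at hr hi ⊢
  refine ⟨?_, ?_, ?_, ?_⟩
  · linear_combination (a * b + a' * b' + c * d + c' * d') * ((a * d - a' * d' - (b * c - b' * c') + 1) * hr +
      (a * d' + a' * d - (b * c' + b' * c)) * hi)
  · linear_combination (a * d + a' * d' + b * c + b' * c') * ((a * d - a' * d' - (b * c - b' * c') + 1) * hr +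
      (a * d' + a' * d - (b * c' + b' * c)) * hi)
  · linear_combination (a' * d - a * d' + b' * c - b * c') * ((a * d - a' * d' - (b * c - b' * c') + 1) * hr +
      (a * d' + a' * d - (b * c' + b' * c)) * hi)
  · linear_combination (a * b + a' * b' - c * d - c' * d') * ((a * d - a' * d' - (b * c - b' * c') + 1) * hr +
      (a * d' + a' * d - (b * c' + b' * c)) * hi)

theorem minkInner_comm (x y : Minkowski) : minkInner x y = minkInner y x := by
  simp only [minkInner]; ring

theorem minkInner_add_right (x y z : Minkowski) :
    minkInner x (y + z) = minkInner x y + minkInner x z := by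
  simp only [minkInner, Pi.add_apply]; ring

/-- The point of the light cone defining a horosphere is unique. -/
theorem horosphereOf_injOn : Set.InjOn horosphereOf lightCone := by
  intro p hp p' hp' h
  obtain ⟨hp0, hpp⟩ := hp
  have key : ∀ n ∈ lightCone,
      minkInner n p * minkInner n (p' - (1 - minkInner p p' / 2) • p) = 0 := by
    intro n hn
    obtain ⟨hn0, hnn⟩ := hn
    by_cases hN : minkInner n p = 0
    · rw [hN, zero_mul]
    have hN' : 0 ≤ minkInner n p := by
      simp only [minkInner] at *
      have : (n 1 * p 1 + n 2 * p 2 + n 3 * p 3) ^ 2 ≤ (n 0 * p 0) ^ 2 := by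
        have e : (n 0 * p 0) ^ 2 = (n 1 ^ 2 + n 2 ^ 2 + n 3 ^ 2) * (p 1 ^ 2 + p 2 ^ 2 + p 3 ^ 2) := by
          linear_combination (p 0 ^ 2) * hnn + (n 1 ^ 2 + n 2 ^ 2 + n 3 ^ 2) * hpp
        rw [e]
        linarith [sq_nonneg (n 1 * p 2 - n 2 * p 1), sq_nonneg (n 1 * p 3 - n 3 * p 1),
          sq_nonneg (n 2 * p 3 - n 3 * p 2)]
      linarith [(abs_le_of_sq_le_sq' this (by positivity)).2]
    have hN0 : 0 < minkInner n p := lt_of_le_of_ne hN' (Ne.symm hN)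
    have hq : (1 / 2 : ℝ) • p + (1 / minkInner n p) • n ∈ horosphereOf p := by
      refine ⟨⟨?_, ?_⟩, ?_⟩
      · simp only [Pi.add_apply, Pi.smul_apply, smul_eq_mul]; positivity
      · have : minkInner ((1 / 2 : ℝ) • p + (1 / minkInner n p) • n)
            ((1 / 2 : ℝ) • p + (1 / minkInner n p) • n) = (1 / 4) * minkInner p p +
            (1 / minkInner n p) ^ 2 * minkInner n n + (1 / minkInner n p) * minkInner n p := by
          generalize 1 / minkInner n p = c
          simp only [minkInner, Pi.add_apply, Pi.smul_apply, smul_eq_mul]; ring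
        rw [this, hpp, hnn]; field_simp; simp
      · have : minkInner ((1 / 2 : ℝ) • p + (1 / minkInner n p) • n) p = (1 / 2) * minkInner p p +
            (1 / minkInner n p) * minkInner n p := by
          generalize 1 / minkInner n p = c
          simp only [minkInner, Pi.add_apply, Pi.smul_apply, smul_eq_mul]; ring
        rw [this, hpp]; field_simp; simp
    rw [h] at hq
    have h1 := hq.2
    have h2 : minkInner ((1 / 2 : ℝ) • p + (1 / minkInner n p) • n) p' = (1 / 2) * minkInner p p' +
        (1 / minkInner n p) * minkInner n p' := by
      generalize 1 / minkInner n p = c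
      simp only [minkInner, Pi.add_apply, Pi.smul_apply, smul_eq_mul]; ring
    have h3 : minkInner n (p' - (1 - minkInner p p' / 2) • p) =
        minkInner n p' - (1 - minkInner p p' / 2) * minkInner n p := by
      generalize 1 - minkInner p p' / 2 = c
      simp only [minkInner, Pi.sub_apply, Pi.smul_apply, smul_eq_mul]; ring
    rw [h2] at h1
    rw [h3]
    field_simp at h1
    have h4 : minkInner n p' - (1 - minkInner p p' / 2) * minkInner n p = 0 := by linarith
    rw [h4, mul_zero]
  have k1 := key ![1, 1, 0, 0] (by simp [lightCone, minkInner])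
  have k2 := key ![1, -1, 0, 0] (by simp [lightCone, minkInner])
  have k3 := key ![1, 0, 1, 0] (by simp [lightCone, minkInner])
  have k4 := key ![1, 0, -1, 0] (by simp [lightCone, minkInner])
  have k5 := key ![1, 0, 0, 1] (by simp [lightCone, minkInner])
  have k6 := key ![1, 0, 0, -1] (by simp [lightCone, minkInner])
  have hw : p' = (1 - minkInner p p' / 2) • p := by
    rw [← sub_eq_zero]
    generalize p' - (1 - minkInner p p' / 2) • p = w at *
    simp [minkInner] at k1 k2 k3 k4 k5 k6 hpp
    have : w 0 = 0 ∧ w 1 = 0 ∧ w 2 = 0 ∧ w 3 = 0 := by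
      have h12 : ¬ (p 0 ^ 2 = p 1 ^ 2 ∧ p 0 ^ 2 = p 2 ^ 2) := by
        rintro ⟨a, b⟩; nlinarith [sq_nonneg (p 3), sq_pos_of_pos hp0]
      have h13 : ¬ (p 0 ^ 2 = p 1 ^ 2 ∧ p 0 ^ 2 = p 3 ^ 2) := by
        rintro ⟨a, b⟩; nlinarith [sq_nonneg (p 2), sq_pos_of_pos hp0]
      have h23 : ¬ (p 0 ^ 2 = p 2 ^ 2 ∧ p 0 ^ 2 = p 3 ^ 2) := by
        rintro ⟨a, b⟩; nlinarith [sq_nonneg (p 1), sq_pos_of_pos hp0]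
      clear key h hp' 
      grind
    ext i; fin_cases i <;> simp [this]
  have hm : minkInner p p' = 0 := by
    rw [hw]
    generalize 1 - minkInner p p' / 2 = c
    simp only [minkInner, Pi.smul_apply, smul_eq_mul] at hpp ⊢
    linear_combination c * hpp
  rw [hm] at hw
  rw [hw]; simp

/-- The point `κ κ*` of the light cone, for a spinor `κ`. -/
def spinorNormal (κ : Fin 2 → ℂ) : Minkowski := ofHermitian (vecMulVec κ (star κ))

/-- The matrix with first column `κ` which maps the basepoint `(1,0,0,0)` to `q`, for `q` in the
horosphere of `κ κ*`. -/
def spinMatrix (κ : Fin 2 → ℂ) (q : Minkowski) : Matrix (Fin 2) (Fin 2) ℂ :=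
  !![κ 0, -(q 0 + q 3) * conj (κ 1) + (q 1 + Complex.I * q 2) * conj (κ 0);
     κ 1, -(q 1 - Complex.I * q 2) * conj (κ 1) + (q 0 - q 3) * conj (κ 0)]

theorem toHermitian_spinorNormal (κ : Fin 2 → ℂ) :
    toHermitian (spinorNormal κ) = vecMulVec κ (star κ) := by
  apply toHermitian_ofHermitian
  ext i j
  simp [vecMulVec_apply, mul_comm]

theorem spinorNormal_mem {κ : Fin 2 → ℂ} (hκ : κ ≠ 0) : spinorNormal κ ∈ lightCone := by
  constructor
  · have h : spinorNormal κ 0 = Complex.normSq (κ 0) + Complex.normSq (κ 1) := by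
      simp [spinorNormal, ofHermitian, vecMulVec_apply, Complex.normSq_apply]
    rw [h]
    by_contra hn
    have h0 := Complex.normSq_nonneg (κ 0)
    have h1 := Complex.normSq_nonneg (κ 1)
    apply hκ
    have k0 : κ 0 = 0 := Complex.normSq_eq_zero.mp (by linarith)
    have k1 : κ 1 = 0 := Complex.normSq_eq_zero.mp (by linarith)
    ext i
    fin_cases i <;> simp [k0, k1]
  · have h : (minkInner (spinorNormal κ) (spinorNormal κ) : ℂ) = 0 := by
      rw [minkInner_self, toHermitian_spinorNormal]
      simp [det_fin_two, vecMulVec_apply]; ring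
    exact_mod_cast h

theorem act_spinorNormal (A : SL2C) (κ : Fin 2 → ℂ) :
    act A (spinorNormal κ) = spinorNormal ((A : Matrix (Fin 2) (Fin 2) ℂ) *ᵥ κ) := by
  apply toHermitian_injective
  rw [toHermitian_act, toHermitian_spinorNormal, toHermitian_spinorNormal, star_mulVec,
    mul_vecMulVec, vecMulVec_mul]

theorem minkInner_spinorNormal (κ : Fin 2 → ℂ) (q : Minkowski) :
    (minkInner q (spinorNormal κ) : ℂ) = (q 0 - q 3) * (κ 0 * conj (κ 0)) +
      (q 0 + q 3) * (κ 1 * conj (κ 1)) - (q 1 + Complex.I * q 2) * (κ 1 * conj (κ 0))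
      - (q 1 - Complex.I * q 2) * (κ 0 * conj (κ 1)) := by
  apply Complex.ext <;>
  simp [minkInner, spinorNormal, ofHermitian, vecMulVec_apply] <;> ring

theorem det_spinMatrix {κ : Fin 2 → ℂ} {q : Minkowski} (hq : q ∈ horosphereOf (spinorNormal κ)) :
    (spinMatrix κ q).det = 1 := by
  have h := minkInner_spinorNormal κ q
  rw [hq.2] at h
  rw [spinMatrix, det_fin_two_of]
  push_cast at h
  linear_combination -h

theorem toHermitian_e0 : toHermitian ![1, 0, 0, 0] = (1 / 2 : ℂ) • 1 := by
  ext i j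
  fin_cases i <;> fin_cases j <;> simp [toHermitian]

/-- The frame matrix over the point `q` of the horosphere of `κ κ*`. -/
def spinSL (κ : Fin 2 → ℂ) (q : horosphereOf (spinorNormal κ)) : SL2C :=
  ⟨spinMatrix κ q, det_spinMatrix q.2⟩

theorem act_spinSL (κ : Fin 2 → ℂ) (q : horosphereOf (spinorNormal κ)) :
    act (spinSL κ q) ![1, 0, 0, 0] = q := by
  apply toHermitian_injective
  obtain ⟨q, ⟨h0, hqq⟩, hqp⟩ := q
  have h := minkInner_spinorNormal κ q
  rw [hqp] at h
  have h' : (q 0 + q 3 : ℂ) * (q 0 - q 3) - (q 1 + Complex.I * q 2) * (q 1 - Complex.I * q 2) =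
      1 := by
    have h1 : (minkInner q q : ℂ) = 1 := by rw [hqq]; simp
    simp only [minkInner] at h1
    push_cast at h1
    linear_combination h1 + (q 2 : ℂ) ^ 2 * Complex.I_sq
  push_cast at h
  rw [toHermitian_act, toHermitian_e0]
  ext i j
  fin_cases i <;> fin_cases j <;>
    simp [spinSL, spinMatrix, toHermitian, Matrix.mul_apply, Fin.sum_univ_two]
  · linear_combination (-(q 0 + q 3 : ℂ) / 2) * h - (κ 0 * conj (κ 0) / 2) * h'
  · linear_combination (-(q 1 + Complex.I * q 2 : ℂ) / 2) * h - (κ 0 * conj (κ 1) / 2) * h'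
  · linear_combination (-(q 1 - Complex.I * q 2 : ℂ) / 2) * h - (κ 1 * conj (κ 0) / 2) * h'
  · linear_combination (-(q 0 - q 3 : ℂ) / 2) * h - (κ 1 * conj (κ 1) / 2) * h'

theorem spinMatrix_of_SL (A : SL2C) :
    spinMatrix ((A : Matrix (Fin 2) (Fin 2) ℂ) *ᵥ ![1, 0]) (act A ![1, 0, 0, 0]) = A := by
  have hH := toHermitian_act A ![1, 0, 0, 0]
  rw [toHermitian_e0] at hH
  have hd := A.det_coe
  rw [det_fin_two] at hd
  replace hd := congrArg conj hd
  generalize act A ![1, 0, 0, 0] = q at *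
  have h00 := congrFun (congrFun hH 0) 0
  have h01 := congrFun (congrFun hH 0) 1
  have h10 := congrFun (congrFun hH 1) 0
  have h11 := congrFun (congrFun hH 1) 1
  simp [toHermitian, Matrix.mul_apply, Fin.sum_univ_two] at h00 h01 h10 h11 hd
  ext i j
  fin_cases i <;> fin_cases j <;>
    simp [spinMatrix, Matrix.mulVec, dotProduct, Fin.sum_univ_two]
  · linear_combination (-2 * conj (A 1 0)) * h00 + (2 * conj (A 0 0)) * h01 + A 0 1 * hd
  · linear_combination (-2 * conj (A 1 0)) * h10 + (2 * conj (A 0 0)) * h11 + A 1 1 * hd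

/-- The first column of a frame matrix is the spinor. -/
theorem spinSL_mulVec (κ : Fin 2 → ℂ) (q : horosphereOf (spinorNormal κ)) :
    (spinSL κ q : Matrix (Fin 2) (Fin 2) ℂ) *ᵥ ![1, 0] = κ := by
  ext i
  fin_cases i <;> simp [spinSL, spinMatrix, Matrix.mulVec, dotProduct, Fin.sum_univ_two]

theorem spinorNormal_one_zero : spinorNormal ![1, 0] = ![1, 0, 0, 1] := by
  ext i
  fin_cases i <;> simp [spinorNormal, ofHermitian, vecMulVec_apply]

theorem act_spinSL_normal (κ : Fin 2 → ℂ) (q : horosphereOf (spinorNormal κ)) :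
    act (spinSL κ q) ![1, 0, 0, 1] = spinorNormal κ := by
  rw [← spinorNormal_one_zero, act_spinorNormal, spinSL_mulVec]

/-- Equivariance of the frame matrices. -/
theorem spinMatrix_equivariant (A : SL2C) (κ : Fin 2 → ℂ) (q : horosphereOf (spinorNormal κ)) :
    spinMatrix ((A : Matrix (Fin 2) (Fin 2) ℂ) *ᵥ κ) (act A q) =
      (A : Matrix (Fin 2) (Fin 2) ℂ) * spinMatrix κ q := by
  have h := spinMatrix_of_SL (A * spinSL κ q)
  rw [act_mul, act_spinSL, Matrix.SpecialLinearGroup.coe_mul, ← Matrix.mulVec_mulVec,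
    spinSL_mulVec] at h
  exact h

theorem act_horosphere_subset (A : SL2C) (κ : Fin 2 → ℂ) :
    act A '' horosphereOf (spinorNormal κ) ⊆
      horosphereOf (spinorNormal ((A : Matrix (Fin 2) (Fin 2) ℂ) *ᵥ κ)) := by
  rintro _ ⟨q, hq, rfl⟩
  have hB : act (A * spinSL κ ⟨q, hq⟩) ![1, 0, 0, 0] = act A q := by rw [act_mul, act_spinSL]
  refine ⟨⟨?_, ?_⟩, ?_⟩
  · rw [← hB]
    generalize A * spinSL κ ⟨q, hq⟩ = B
    have h0 : act B ![1, 0, 0, 0] 0 = (Complex.normSq (B 0 0) + Complex.normSq (B 0 1) +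
        Complex.normSq (B 1 0) + Complex.normSq (B 1 1)) / 2 := by
      simp [act, ofHermitian, toHermitian, Matrix.mul_apply, Fin.sum_univ_two,
        Complex.normSq_apply]
      ring
    rw [h0]
    have n1 := Complex.normSq_nonneg (B 0 0)
    have n2 := Complex.normSq_nonneg (B 0 1)
    have n3 := Complex.normSq_nonneg (B 1 0)
    have n4 := Complex.normSq_nonneg (B 1 1)
    by_contra hn
    have z1 : B 0 0 = 0 := Complex.normSq_eq_zero.mp (by linarith)
    have z2 : B 0 1 = 0 := Complex.normSq_eq_zero.mp (by linarith)
    have hd := B.det_coe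
    rw [det_fin_two, z1, z2] at hd
    simp at hd
  · rw [minkInner_act_self]; exact hq.1.2
  · rw [← act_spinorNormal, minkInner_act]; exact hq.2

theorem act_horosphere (A : SL2C) (κ : Fin 2 → ℂ) :
    act A '' horosphereOf (spinorNormal κ) =
      horosphereOf (spinorNormal ((A : Matrix (Fin 2) (Fin 2) ℂ) *ᵥ κ)) := by
  refine Set.Subset.antisymm (act_horosphere_subset A κ) fun q hq => ?_
  refine ⟨act A⁻¹ q, ?_, ?_⟩
  · have h := act_horosphere_subset A⁻¹ ((A : Matrix (Fin 2) (Fin 2) ℂ) *ᵥ κ)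
      (Set.mem_image_of_mem _ hq)
    rwa [Matrix.mulVec_mulVec, ← Matrix.SpecialLinearGroup.coe_mul, inv_mul_cancel,
      Matrix.SpecialLinearGroup.coe_one, Matrix.one_mulVec] at h
  · rw [← act_mul, mul_inv_cancel, act_one]

/-- A parabolic isometry which preserves the horosphere of `κ κ*` maps `κ` to `±κ`. -/
theorem parabolic_mulVec (A : SL2C) (hA : IsParabolic A) {κ : Fin 2 → ℂ} (hκ : κ ≠ 0)
    (h : act A '' horosphereOf (spinorNormal κ) = horosphereOf (spinorNormal κ)) :
    (A : Matrix (Fin 2) (Fin 2) ℂ) *ᵥ κ = κ ∨ (A : Matrix (Fin 2) (Fin 2) ℂ) *ᵥ κ = -κ := by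
  have hne : (A : Matrix (Fin 2) (Fin 2) ℂ) *ᵥ κ ≠ 0 := fun h0 => hκ (by
    have := congrArg (fun v => (↑(A⁻¹) : Matrix (Fin 2) (Fin 2) ℂ) *ᵥ v) h0
    rwa [Matrix.mulVec_mulVec, ← Matrix.SpecialLinearGroup.coe_mul, inv_mul_cancel,
      Matrix.SpecialLinearGroup.coe_one, Matrix.one_mulVec, Matrix.mulVec_zero] at this)
  rw [act_horosphere] at h
  have hp := horosphereOf_injOn (spinorNormal_mem hne) (spinorNormal_mem hκ) h
  have hm := congrArg toHermitian hp
  rw [toHermitian_spinorNormal, toHermitian_spinorNormal] at hm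
  have hm' (i j : Fin 2) := congrFun (congrFun hm i) j
  simp only [vecMulVec_apply, Pi.star_apply, Complex.star_def] at hm'
  have hε : ∃ ε : ℂ, (A : Matrix (Fin 2) (Fin 2) ℂ) *ᵥ κ = ε • κ := by
    obtain ⟨j, hj⟩ := Function.ne_iff.mp hκ
    have hj' : ((A : Matrix (Fin 2) (Fin 2) ℂ) *ᵥ κ) j ≠ 0 := fun h0 => by
      have := hm' j j
      rw [h0] at this
      simp at this
      exact hj this
    refine ⟨conj (κ j) / conj (((A : Matrix (Fin 2) (Fin 2) ℂ) *ᵥ κ) j), ?_⟩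
    ext i
    have := hm' i j
    have hc : conj (((A : Matrix (Fin 2) (Fin 2) ℂ) *ᵥ κ) j) ≠ 0 := by simpa using hj'
    rw [Pi.smul_apply, smul_eq_mul, div_mul_eq_mul_div, eq_div_iff hc, this]
    ring
  obtain ⟨ε, hε⟩ := hε
  have hd := A.det_coe
  rw [det_fin_two] at hd
  have e0 := congrFun hε 0
  have e1 := congrFun hε 1
  simp [Matrix.mulVec, dotProduct, Fin.sum_univ_two] at e0 e1
  obtain ⟨j, hj⟩ := Function.ne_iff.mp hκ
  have hch : (ε ^ 2 - (A : Matrix (Fin 2) (Fin 2) ℂ).trace * ε + 1) * κ j = 0 := by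
    rw [trace_fin_two]
    fin_cases j
    · change _ * κ 0 = 0
      linear_combination (A 1 1 - ε) * e0 - A 0 1 * e1 - κ 0 * hd
    · change _ * κ 1 = 0
      linear_combination (A 0 0 - ε) * e1 - A 1 0 * e0 - κ 1 * hd
  have hch' := (mul_eq_zero.mp hch).resolve_right hj
  rw [hε]
  rcases hA with hA | hA <;> rw [hA] at hch'
  · left
    have : (ε - 1) ^ 2 = 0 := by linear_combination hch'
    rw [sub_eq_zero.mp (pow_eq_zero_iff two_ne_zero |>.mp this), one_smul]
  · right
    have : (ε + 1) ^ 2 = 0 := by linear_combination hch'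
    rw [eq_neg_of_add_eq_zero_left (pow_eq_zero_iff two_ne_zero |>.mp this), neg_one_smul]

theorem spinMatrix_neg (κ : Fin 2 → ℂ) (q : Minkowski) : spinMatrix (-κ) q = -spinMatrix κ q := by
  ext i j
  fin_cases i <;> fin_cases j <;> simp [spinMatrix] <;> ring

/-- The horosphere of a spinor. -/
def spinorHorosphere (κ : {κ : Fin 2 → ℂ // κ ≠ 0}) : Horosphere where
  carrier := horosphereOf (spinorNormal κ)
  exists_normal := ⟨spinorNormal κ, spinorNormal_mem κ.2, rfl⟩

theorem spinorHorosphere_normal (κ : {κ : Fin 2 → ℂ // κ ≠ 0}) :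
    (spinorHorosphere κ).normal = spinorNormal κ := by
  have h := (spinorHorosphere κ).exists_normal.choose_spec
  exact horosphereOf_injOn h.1 (spinorNormal_mem κ.2) h.2.symm

theorem spinorHorosphere_isUnitParallel (κ : {κ : Fin 2 → ℂ // κ ≠ 0}) :
    (spinorHorosphere κ).IsUnitParallel fun q => act (spinSL κ q) ![0, 0, 1, 0] where
  tangent_hyperboloid q := by
    have h := minkInner_act (spinSL κ q) ![0, 0, 1, 0] ![1, 0, 0, 0]
    have h' := act_spinSL κ q
    rw [h'] at h
    exact h.trans (by simp [minkInner])
  tangent_horosphere q := by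
    rw [spinorHorosphere_normal, ← act_spinSL_normal κ q, minkInner_act]
    simp [minkInner]
  unit q := by
    rw [minkInner_act_self]
    simp [minkInner]
  parallel A hA h q q' hq := by
    have he := spinMatrix_equivariant A κ q
    rw [← hq] at he
    rcases parabolic_mulVec A hA κ.2 h with hk | hk
    · rw [hk] at he
      have : spinSL κ q' = A * spinSL κ q := Subtype.ext he
      rw [this, act_mul]
    · rw [hk, spinMatrix_neg] at he
      have : spinSL κ q' = -(A * spinSL κ q) :=
        Subtype.ext (by rw [Matrix.SpecialLinearGroup.coe_neg]; exact neg_eq_iff_eq_neg.mp he)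
      rw [this, act_neg, act_mul]

theorem continuous_spinSL (κ : Fin 2 → ℂ) : Continuous (spinSL κ) := by
  have h (i : Fin 4) : Continuous fun q : horosphereOf (spinorNormal κ) =>
      (((q : Minkowski) i : ℝ) : ℂ) :=
    Complex.continuous_ofReal.comp ((continuous_apply i).comp continuous_subtype_val)
  refine Continuous.subtype_mk (continuous_matrix fun i j => ?_) _
  fin_cases i <;> fin_cases j
  · exact continuous_const
  · exact (((h 0).add (h 3)).neg.mul continuous_const).add
      (((h 1).add (continuous_const.mul (h 2))).mul continuous_const)
  · exact continuous_const
  · exact (((h 1).sub (continuous_const.mul (h 2))).neg.mul continuous_const).add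
      (((h 0).sub (h 3)).mul continuous_const)

theorem act_spinSL_outNormal (κ : Fin 2 → ℂ) (q : horosphereOf (spinorNormal κ)) :
    act (spinSL κ q) ![0, 0, 0, 1] = spinorNormal κ - q := by
  rw [eq_sub_iff_add_eq]
  conv_lhs => rw [← act_spinSL κ q]
  rw [← act_add, ← act_spinSL_normal κ q]
  congr 1
  ext i
  fin_cases i <;> simp

theorem spinProj_spinSL (κ : {κ : Fin 2 → ℂ // κ ≠ 0}) (q : (spinorHorosphere κ).carrier) :
    spinProj (spinSL κ q) =
      (spinorHorosphere κ).outFrame (fun q => act (spinSL κ q) ![0, 0, 1, 0]) q := by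
  have h0 : (spinProj (spinSL κ q)).pos = q := act_spinSL κ q
  have h1 : (spinProj (spinSL κ q)).v1 = (spinorHorosphere κ).outNormal q := by
    rw [Horosphere.outNormal, spinorHorosphere_normal]
    exact act_spinSL_outNormal κ q
  have h3 := spinProj_v3 (spinSL κ q)
  rw [h0, h1] at h3
  exact Frame.ext h0 h1 rfl h3

theorem spinProj_spinSL_mul (κ : {κ : Fin 2 → ℂ // κ ≠ 0}) (q : (spinorHorosphere κ).carrier) :
    spinProj (spinSL κ q * rotMatrix Real.pi) =
      (spinorHorosphere κ).inFrame (fun q => act (spinSL κ q) ![0, 0, 1, 0]) q := by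
  have h := spinProj_mul_rotMatrix (spinSL κ q) Real.pi
  have h0 : (spinProj (spinSL κ q * rotMatrix Real.pi)).pos = q := by
    rw [h]
    exact act_spinSL κ q
  have h1 : (spinProj (spinSL κ q * rotMatrix Real.pi)).v1 = (spinorHorosphere κ).inNormal q := by
    rw [h, spinProj_spinSL, Horosphere.inNormal]
    simp [Frame.rotateSecond, Horosphere.outFrame, Horosphere.outNormal]
  have h2 : (spinProj (spinSL κ q * rotMatrix Real.pi)).v2 =
      act (spinSL κ q) ![0, 0, 1, 0] := by rw [h]; rfl
  have h3 := spinProj_v3 (spinSL κ q * rotMatrix Real.pi)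
  rw [h0, h1, h2] at h3
  exact Frame.ext h0 h1 h2 h3

/-- The spinor–horosphere correspondence, from nonzero spinors to spin-decorated horospheres. Its
underlying decorated horosphere is given by the flag of `κ`: the horosphere is that of the point
`κ κ*` of the light cone, and its decoration points along the flag (see the two theorems below).
The outward spin decoration consists of all `A` in `SL(2,ℂ)` with first column `κ`. This choice of
lift to spin frames depends continuously on `κ` and is `SL(2,ℂ)`-equivariant; `(1,0)` corresponds to
a spin decoration which passes through the spin frame `1`. -/
def spinLift (κ : {κ : Fin 2 → ℂ // κ ≠ 0}) : SpinDecoratedHorosphere where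
  toHorosphere := spinorHorosphere κ
  wout := fun q => spinSL κ q
  win := fun q => spinSL κ q * rotMatrix Real.pi
  continuous_wout := continuous_spinSL κ
  continuous_win := (continuous_spinSL κ).mul continuous_const
  associated := by
    refine ⟨_, spinorHorosphere_isUnitParallel κ, fun q => spinProj_spinSL_mul κ q,
      fun q => spinProj_spinSL κ q, fun q => spinRotateSecond_mul _ _, fun q => ?_⟩
    have h := spinRotateSecond_mul (spinSL κ q * rotMatrix Real.pi) (-Real.pi)
    rwa [mul_assoc, rotMatrix_pi_mul_neg_pi, mul_one] at h

/-- The horosphere of `κ` is defined by the point `κ κ*` of the light cone. -/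
theorem spinLift_normal (κ : {κ : Fin 2 → ℂ // κ ≠ 0}) :
    toHermitian (spinLift κ).normal = vecMulVec κ (star (κ : Fin 2 → ℂ)) := by
  have h : (spinLift κ).normal = spinorNormal κ := spinorHorosphere_normal κ
  rw [h, toHermitian_spinorNormal]

/-- The decoration of the horosphere of `κ = (ξ, η)` points along the flag of `κ`: it lies in the
oriented plane spanned by `κ κ*` and `κ Z* + Z κ*`, where `Z = (i η̄, -i ξ̄)`. -/
theorem spinLift_direction (κ : {κ : Fin 2 → ℂ // κ ≠ 0}) (q : (spinLift κ).carrier) :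
    ∃ a b : ℝ, 0 < b ∧ toHermitian ((spinLift κ).direction q) =
      (a : ℂ) • vecMulVec κ (star (κ : Fin 2 → ℂ)) +
      (b : ℂ) • (vecMulVec κ (star ![Complex.I * conj (κ.1 1), -Complex.I * conj (κ.1 0)]) +
        vecMulVec ![Complex.I * conj (κ.1 1), -Complex.I * conj (κ.1 0)] (star (κ : Fin 2 → ℂ))) := by
  obtain ⟨κ, hκ⟩ := κ
  have hN : 0 < spinorNormal κ 0 := (spinorNormal_mem hκ).1
  have hN' : (spinorNormal κ 0 : ℂ) = κ 0 * conj (κ 0) + κ 1 * conj (κ 1) := by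
    apply Complex.ext <;> simp [spinorNormal, ofHermitian, vecMulVec_apply] <;> ring
  have hdir : toHermitian ((spinLift ⟨κ, hκ⟩).direction q) = spinMatrix κ q *
      toHermitian ![0, 0, 1, 0] * (spinMatrix κ q)ᴴ := toHermitian_act (spinSL κ q) ![0, 0, 1, 0]
  have hd : (spinMatrix κ q).det = 1 := det_spinMatrix q.2
  have c0 : spinMatrix κ q 0 0 = κ 0 := rfl
  have c1 : spinMatrix κ q 1 0 = κ 1 := rfl
  rw [det_fin_two] at hd
  rw [hdir]
  generalize spinMatrix κ q = B at *
  generalize spinorNormal κ 0 = N at *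
  rw [c0, c1] at hd
  have hNc : (N : ℂ) ≠ 0 := by exact_mod_cast hN.ne'
  obtain ⟨c, hc⟩ : ∃ c, c = (conj (κ 0) * B 0 1 + conj (κ 1) * B 1 1) / N := ⟨_, rfl⟩
  have b0 : B 0 1 = c * κ 0 - conj (κ 1) * (N : ℂ)⁻¹ := by
    rw [hc]
    field_simp
    rw [hN']
    linear_combination (-conj (κ 1)) * hd
  have b1 : B 1 1 = c * κ 1 + conj (κ 0) * (N : ℂ)⁻¹ := by
    rw [hc]
    field_simp
    rw [hN']
    linear_combination (conj (κ 0)) * hd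
  have him : (c.im : ℂ) = (conj c - c) * Complex.I / 2 := by
    apply Complex.ext <;> simp
  refine ⟨c.im, N⁻¹ / 2, by positivity, ?_⟩
  rw [him]
  ext i j
  simp only [Matrix.add_apply, Matrix.smul_apply, vecMulVec_apply, Pi.star_apply]
  fin_cases i <;> fin_cases j <;>
    simp [toHermitian, Matrix.mul_apply, Fin.sum_univ_two, c0, c1, b0, b1] <;> ring

/-- The outward spin decoration consists of all `A` in `SL(2,ℂ)` with first column `κ`. -/
theorem range_spinLift_wout (κ : {κ : Fin 2 → ℂ // κ ≠ 0}) :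
    Set.range (spinLift κ).wout = {A : SL2C | ∀ r, A r 0 = κ.1 r} := by
  ext A
  constructor
  · rintro ⟨q, rfl⟩ r
    fin_cases r <;> rfl
  · intro hA
    have hk : (A : Matrix (Fin 2) (Fin 2) ℂ) *ᵥ ![1, 0] = κ := by
      ext r
      rw [← hA r]
      simp [Matrix.mulVec, dotProduct, Fin.sum_univ_two]
    have h0 : (![1, 0, 0, 0] : Minkowski) ∈ horosphereOf (spinorNormal ![1, 0]) := by
      rw [spinorNormal_one_zero]
      simp [horosphereOf, hyperboloid, minkInner]
    have hq := act_horosphere_subset A ![1, 0] (Set.mem_image_of_mem _ h0)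
    rw [hk] at hq
    refine ⟨⟨_, hq⟩, Subtype.ext ?_⟩
    have h := spinMatrix_of_SL A
    rw [hk] at h
    exact h

/-- The spin-decorated horosphere `w` corresponds to the spinor `κ`. -/
def IsSpinVectorOf (κ : Fin 2 → ℂ) (w : SpinDecoratedHorosphere) : Prop :=
  ∃ h : κ ≠ 0, spinLift ⟨κ, h⟩ = w

end

end SpinHyp

/-!
The second column of a matrix in `SL(2,ℂ)` with first column `κ` runs over an affine line, so a
horosphere is connected and a spin decoration is determined by one spin frame; its first column is
the spin vector. The complex distance between two spin frames is `d` when the second is the first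
times `diag(e^{d/2}, e^{-d/2})`, which makes the lambda length of two spinors their determinant.
At the highest point of the horosphere of `κ = (ξ, η)` the decoration points along `i η̄ / η`
(along `i ξ / ξ̄` if `η = 0`), so it is specified by `i` and centred at a real point or `∞` exactly
when `κ` is real. Vertices with real spin vectors coincide when the determinant vanishes, hence
degeneracy is a condition on the rank. Finally, scaling a real vector into the upper half plane
does not change the product of the three determinants of a triple, and for vectors there the sign
of a determinant is the order of the quotients; so positive minors force the cyclic order.
-/

namespace SpinHyp

/-! ### Lifts of frames to `SL(2,ℂ)` -/

theorem act_eq_self_iff_commute {A : SL2C} (hA : act A ![1, 0, 0, 0] = ![1, 0, 0, 0])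
    (x : Minkowski) :
    act A x = x ↔ Commute (A : Matrix (Fin 2) (Fin 2) ℂ) (toHermitian x) := by
  have unitary : (A : Matrix (Fin 2) (Fin 2) ℂ) * (A : Matrix (Fin 2) (Fin 2) ℂ)ᴴ = 1 := by
    have h := congrArg toHermitian hA
    rw [toHermitian_act, toHermitian_e0, mul_smul_one, smul_mul_assoc] at h
    exact smul_right_injective _ (by norm_num : (1 / 2 : ℂ) ≠ 0) h
  have unitary' := mul_eq_one_comm.mp unitary
  rw [← toHermitian_injective.eq_iff, toHermitian_act, commute_iff_eq]
  constructor <;> intro h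
  · calc _ = A.1 * toHermitian x * ((A.1)ᴴ * A.1) := by rw [unitary', mul_one]
      _ = _ := by rw [← mul_assoc, h]
  · rw [h, mul_assoc, unitary, mul_one]

theorem eq_one_or_eq_neg_one_of_act_eq {A : SL2C} (h0 : act A ![1, 0, 0, 0] = ![1, 0, 0, 0])
    (h2 : act A ![0, 0, 1, 0] = ![0, 0, 1, 0]) (h3 : act A ![0, 0, 0, 1] = ![0, 0, 0, 1]) :
    A = 1 ∨ A = -1 := by
  have c2 := (act_eq_self_iff_commute h0 _).mp h2
  have c3 := (act_eq_self_iff_commute h0 _).mp h3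
  have diagonal : A 0 1 = 0 ∧ A 1 0 = 0 := by
    have h01 := congrFun₂ c3.eq 0 1
    have h10 := congrFun₂ c3.eq 1 0
    simp only [toHermitian, Matrix.mul_apply, Fin.sum_univ_two, of_apply, cons_val', cons_val_zero,
      cons_val_one, cons_val_fin_one, cons_val] at h01 h10
    push_cast at h01 h10
    exact ⟨by linear_combination -h01, by linear_combination h10⟩
  have scalar : A 0 0 = A 1 1 := by
    have h01 := congrFun₂ c2.eq 0 1
    simp only [toHermitian, Matrix.mul_apply, Fin.sum_univ_two, of_apply, cons_val', cons_val_zero,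
      cons_val_one, cons_val_fin_one, cons_val] at h01
    push_cast at h01
    linear_combination (-2 * Complex.I) * h01 + (A 0 0 - A 1 1) * Complex.I_sq
  have square : A 1 1 ^ 2 = 1 := by
    have h := A.det_coe
    rw [det_fin_two, diagonal.1, scalar] at h
    linear_combination h
  refine (sq_eq_one_iff.mp square).imp (fun h => ?_) (fun h => ?_) <;>
    ext i j <;> fin_cases i <;> fin_cases j <;> simp [diagonal, scalar, h]

theorem eq_or_eq_neg_of_spinProj_eq {A B : SL2C} (h : spinProj A = spinProj B) :
    A = B ∨ A = -B := by
  have fixes (x : Minkowski) (hx : act A x = act B x) : act (B⁻¹ * A) x = x := by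
    rw [act_mul, hx, ← act_mul, inv_mul_cancel, act_one]
  refine (eq_one_or_eq_neg_one_of_act_eq (fixes _ (congrArg Frame.pos h))
    (fixes _ (congrArg Frame.v2 h)) (fixes _ (congrArg Frame.v1 h))).imp
    (fun hBA => ?_) (fun hBA => ?_)
  · rw [inv_mul_eq_iff_eq_mul, mul_one] at hBA
    exact hBA
  · rw [inv_mul_eq_iff_eq_mul, mul_neg_one] at hBA
    exact hBA

theorem ne_neg_self (A : SL2C) : A ≠ -A := by
  intro h
  have zero : (A : Matrix (Fin 2) (Fin 2) ℂ) = 0 := by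
    ext i j
    exact self_eq_neg.mp (congrArg (fun B : SL2C => B i j) h)
  exact A.det_ne_zero (by rw [zero, det_zero])

theorem eq_or_eq_neg_of_lifts {X : Type*} [TopologicalSpace X] [PreconnectedSpace X]
    {f g : X → SL2C} (hf : Continuous f) (hg : Continuous g)
    (h : ∀ x, spinProj (f x) = spinProj (g x)) : f = g ∨ f = -g := by
  have continuous_neg_g : Continuous (-g) := Continuous.subtype_mk hg.subtype_val.neg _
  have compl : {x | f x = g x}ᶜ = {x | f x = (-g) x} := by
    ext x
    exact ⟨(eq_or_eq_neg_of_spinProj_eq (h x)).resolve_left,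
      fun hx hx' => ne_neg_self (g x) (hx'.symm.trans hx)⟩
  have clopen : IsClopen {x | f x = g x} :=
    ⟨isClosed_eq hf hg, by
      rw [← isClosed_compl_iff, compl]; exact isClosed_eq hf continuous_neg_g⟩
  rcases isClopen_iff.mp clopen with empty | univ
  · rw [empty, Set.compl_empty] at compl
    exact .inr (funext (Set.eq_univ_iff_forall.mp compl.symm))
  · exact .inl (funext (Set.eq_univ_iff_forall.mp univ))

theorem SpinTransport.unique {F : ℝ → Frame} {s s₁ s₂ : SL2C} (h₁ : SpinTransport F s s₁)
    (h₂ : SpinTransport F s s₂) : s₁ = s₂ := by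
  obtain ⟨γ₁, continuous₁, lifts₁, start₁, rfl⟩ := h₁
  obtain ⟨γ₂, continuous₂, lifts₂, start₂, rfl⟩ := h₂
  rcases eq_or_eq_neg_of_lifts continuous₁ continuous₂ fun t => (lifts₁ t).trans (lifts₂ t).symm
    with rfl | rfl
  · rfl
  · exact absurd (start₂.trans start₁.symm) (ne_neg_self _)

/-! ### Complex distance -/

/-- The loxodromic element of `SL(2,ℂ)` which translates by `d.re` along the geodesic directed by
the first vector of the base frame and rotates by `d.im` about it. -/
noncomputable def loxMatrix (d : ℂ) : SL2C :=
  ⟨!![Complex.exp (d / 2), 0; 0, Complex.exp (-d / 2)], by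
    rw [det_fin_two_of, ← Complex.exp_add]; simp [neg_div]⟩

theorem loxMatrix_zero : loxMatrix 0 = 1 := by
  ext i j; fin_cases i <;> fin_cases j <;> simp [loxMatrix]

theorem loxMatrix_add (d e : ℂ) : loxMatrix (d + e) = loxMatrix d * loxMatrix e := by
  apply Subtype.ext
  rw [Matrix.SpecialLinearGroup.coe_mul]
  simp [loxMatrix, ← Complex.exp_add, add_div, add_comm]

theorem continuous_loxMatrix : Continuous loxMatrix := by
  refine Continuous.subtype_mk (continuous_matrix fun i j => ?_) _
  fin_cases i <;> fin_cases j <;>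
    simp only [of_apply, cons_val', cons_val_fin_one, cons_val_zero, cons_val_one, Fin.zero_eta,
      Fin.mk_one] <;> fun_prop

theorem exp_half_mul_conj_exp_half (d : ℂ) :
    Complex.exp (d / 2) * conj (Complex.exp (d / 2)) = Complex.cosh d.re + Complex.sinh d.re := by
  rw [← Complex.exp_conj, ← Complex.exp_add, Complex.cosh_add_sinh]
  congr 1
  apply Complex.ext <;> simp [Complex.conj_ofNat, neg_div]

theorem exp_half_mul_conj_exp_neg_half (d : ℂ) :
    Complex.exp (d / 2) * conj (Complex.exp (-d / 2)) =
      Complex.cos d.im + Complex.sin d.im * Complex.I := by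
  rw [← Complex.exp_conj, ← Complex.exp_add, ← Complex.exp_mul_I]
  congr 1
  apply Complex.ext <;> simp [Complex.conj_ofNat, neg_div]

theorem act_loxMatrix (d : ℂ) (x : Minkowski) : act (loxMatrix d) x =
    ![Real.cosh d.re * x 0 + Real.sinh d.re * x 3, Real.cos d.im * x 1 - Real.sin d.im * x 2,
      Real.sin d.im * x 1 + Real.cos d.im * x 2, Real.sinh d.re * x 0 + Real.cosh d.re * x 3] := by
  have dilation := exp_half_mul_conj_exp_half d
  have dilation_neg := exp_half_mul_conj_exp_half (-d)
  have phase := exp_half_mul_conj_exp_neg_half d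
  have phase_neg := exp_half_mul_conj_exp_neg_half (-d)
  simp only [Complex.neg_re, Complex.neg_im, Complex.ofReal_neg, Complex.cosh_neg,
    Complex.sinh_neg, Complex.cos_neg, Complex.sin_neg, neg_neg] at dilation_neg phase_neg
  apply toHermitian_injective
  rw [toHermitian_act]
  ext i j
  fin_cases i <;> fin_cases j <;>
    simp [loxMatrix, toHermitian, Matrix.mul_apply, Fin.sum_univ_two, - Complex.exp_conj]
  · linear_combination ((x 0 + x 3) / 2) * dilation
  · linear_combination ((x 1 + Complex.I * x 2) / 2) * phase +
      (x 2 : ℂ) / 2 * Complex.sin d.im * Complex.I_sq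
  · linear_combination ((x 1 - Complex.I * x 2) / 2) * phase_neg +
      (x 2 : ℂ) / 2 * Complex.sin d.im * Complex.I_sq
  · linear_combination ((x 0 - x 3) / 2) * dilation_neg

theorem act_add_smul (A : SL2C) (a b : ℝ) (x y : Minkowski) :
    act A (a • x + b • y) = a • act A x + b • act A y := by
  rw [act_add, act_smul, act_smul]

theorem spinProj_mul_loxMatrix (A : SL2C) (d : ℂ) :
    spinProj (A * loxMatrix d) = ((spinProj A).translate d.re).rotateFirst d.im := by
  ext1
  all_goals
    simp only [spinProj, Frame.translate, Frame.rotateFirst, act_mul, act_loxMatrix,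
      ← act_add_smul]
    congr 1
    ext i
    fin_cases i <;> simp

theorem spinTranslate_mul (A : SL2C) (ρ : ℝ) : SpinTranslate ρ A (A * loxMatrix ρ) := by
  refine ⟨fun t => A * loxMatrix ((t * ρ : ℝ) : ℂ), ?_, fun t => ?_, ?_, ?_⟩
  · exact continuous_const.mul (continuous_loxMatrix.comp (by fun_prop))
  · rw [spinProj_mul_loxMatrix]
    simp [Frame.rotateFirst]
  · simp [loxMatrix_zero]
  · simp

theorem spinRotateFirst_mul (A : SL2C) (θ : ℝ) :
    SpinRotateFirst θ A (A * loxMatrix (θ * Complex.I)) := by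
  refine ⟨fun t => A * loxMatrix ((t * θ : ℝ) * Complex.I), ?_, fun t => ?_, ?_, ?_⟩
  · exact continuous_const.mul (continuous_loxMatrix.comp (by fun_prop))
  · rw [spinProj_mul_loxMatrix]
    simp [Frame.translate]
  · simp [loxMatrix_zero]
  · simp

theorem isComplexDistance_iff {s₁ s₂ : SL2C} {d : ℂ} :
    IsComplexDistance s₁ s₂ d ↔ s₂ = s₁ * loxMatrix d := by
  have split : s₁ * loxMatrix d = s₁ * loxMatrix d.re * loxMatrix (d.im * Complex.I) := by
    rw [mul_assoc, ← loxMatrix_add, Complex.re_add_im]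
  rw [split]
  constructor
  · rintro ⟨s, translate, rotate⟩
    obtain rfl := translate.unique (spinTranslate_mul s₁ d.re)
    exact rotate.unique (spinRotateFirst_mul _ d.im)
  · rintro rfl
    exact ⟨_, spinTranslate_mul _ _, spinRotateFirst_mul _ _⟩

/-! ### Determinants and quotients -/

/-- The antisymmetric bilinear form on pairs, i.e. the determinant of the matrix with columns `v`
and `w`; on spinors it computes lambda lengths. -/
def bracket {R : Type*} [CommRing R] (v w : Fin 2 → R) : R := v 0 * w 1 - w 0 * v 1

theorem bracket_smul_smul {R : Type*} [CommRing R] (a b : R) (v w : Fin 2 → R) :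
    bracket (a • v) (b • w) = a * b * bracket v w := by
  simp only [bracket, Pi.smul_apply, smul_eq_mul]
  ring

theorem bracket_swap {R : Type*} [CommRing R] (v w : Fin 2 → R) : bracket w v = -bracket v w := by
  simp only [bracket]
  ring

theorem bracket_map {R S : Type*} [CommRing R] [CommRing S] (f : R →+* S) (v w : Fin 2 → R) :
    bracket (f ∘ v) (f ∘ w) = f (bracket v w) := by
  simp [bracket]

theorem det_submatrix_pair {R n : Type*} [CommRing R] (M : Matrix (Fin 2) n R) (i j : n) :
    (M.submatrix id ![i, j]).det = bracket (M.col i) (M.col j) := by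
  simp [det_fin_two, bracket]

theorem ne_zero_of_bracket_pos {ι R : Type*} [LinearOrder ι] [Nontrivial ι] [CommRing R]
    [Preorder R] {v : ι → Fin 2 → R} (pos : ∀ i j, i < j → 0 < bracket (v i) (v j)) (i : ι) :
    v i ≠ 0 := by
  intro zero
  obtain ⟨j, hj⟩ := exists_ne i
  rcases hj.lt_or_gt with h | h
  · exact (pos j i h).ne' (by simp [bracket, zero])
  · exact (pos i j h).ne' (by simp [bracket, zero])

/-- The point `v 0 / v 1` of the projective line over `K`, which is `∞` if `v 1 = 0`. -/
noncomputable def ratio {K : Type*} [Field K] (v : Fin 2 → K) : OnePoint K :=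
  open Classical in if v 1 = 0 then ∞ else ((v 0 / v 1 : K) : OnePoint K)

section Field

variable {K : Type*} [Field K] {v w : Fin 2 → K}

theorem ratio_of_eq_zero (h : v 1 = 0) : ratio v = ∞ := if_pos h

theorem ratio_of_ne_zero (h : v 1 ≠ 0) : ratio v = ((v 0 / v 1 : K) : OnePoint K) := if_neg h

theorem apply_zero_ne_zero (hv : v ≠ 0) (h : v 1 = 0) : v 0 ≠ 0 :=
  fun h0 => hv (funext (Fin.forall_fin_two.mpr ⟨h0, h⟩))

theorem ratio_eq_ratio_iff (hv : v ≠ 0) (hw : w ≠ 0) : ratio v = ratio w ↔ bracket v w = 0 := by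
  rw [bracket]
  by_cases hv1 : v 1 = 0 <;> by_cases hw1 : w 1 = 0
  · simp [ratio_of_eq_zero, hv1, hw1]
  · simp [ratio_of_eq_zero hv1, ratio_of_ne_zero hw1, hv1, hw1, apply_zero_ne_zero hv hv1]
  · simp [ratio_of_ne_zero hv1, ratio_of_eq_zero hw1, hv1, hw1, apply_zero_ne_zero hw hw1]
  · rw [ratio_of_ne_zero hv1, ratio_of_ne_zero hw1, OnePoint.coe_eq_coe, div_eq_div_iff hv1 hw1,
      sub_eq_zero]

theorem ratio_smul {a : K} (ha : a ≠ 0) (v : Fin 2 → K) : ratio (a • v) = ratio v := by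
  by_cases h : v 1 = 0
  · rw [ratio_of_eq_zero h, ratio_of_eq_zero (by simp [h])]
  · rw [ratio_of_ne_zero h, ratio_of_ne_zero (by simp [h, ha])]
    simp [mul_div_mul_left _ _ ha]

theorem ratio_map {L : Type*} [Field L] (f : K →+* L) (v : Fin 2 → K) :
    ratio (f ∘ v) = (ratio v).map f := by
  by_cases h : v 1 = 0
  · rw [ratio_of_eq_zero h, ratio_of_eq_zero (by simp [h]), OnePoint.map_infty]
  · rw [ratio_of_ne_zero h, ratio_of_ne_zero (by simpa using h), OnePoint.map_some]
    simp

end Field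

/-! ### Lambda lengths -/

/-- The coordinate `T - Z` of Minkowski space, which is the reciprocal of the height in the upper
half space model. -/
noncomputable def invHeight : Minkowski →L[ℝ] ℝ :=
  .proj (R := ℝ) (φ := fun _ : Fin 4 => ℝ) 0 - .proj (R := ℝ) (φ := fun _ : Fin 4 => ℝ) 3

/-- The coordinate `X + iY` of Minkowski space, which is the horizontal position multiplied by the
reciprocal of the height in the upper half space model. -/
noncomputable def horizontal : Minkowski →L[ℝ] ℂ :=
  Complex.ofRealCLM ∘L .proj (R := ℝ) (φ := fun _ : Fin 4 => ℝ) 1 +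
    Complex.I • Complex.ofRealCLM ∘L .proj (R := ℝ) (φ := fun _ : Fin 4 => ℝ) 2

theorem invHeight_apply (x : Minkowski) : invHeight x = x 0 - x 3 := rfl

theorem horizontal_apply (x : Minkowski) : horizontal x = x 1 + Complex.I * x 2 := rfl

theorem invHeight_eq_toHermitian (x : Minkowski) : (invHeight x : ℂ) = 2 * toHermitian x 1 1 := by
  simp [invHeight_apply, toHermitian]
  ring

theorem horizontal_eq_toHermitian (x : Minkowski) : horizontal x = 2 * toHermitian x 0 1 := by
  simp [horizontal_apply, toHermitian]
  ring

theorem Horosphere.centre_eq (h : Horosphere) :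
    h.centre = ratio ![horizontal h.normal, invHeight h.normal] := by
  simp [centre, ratio, horizontal_apply, invHeight_apply, sub_eq_zero, ← Complex.ofReal_sub]

theorem normal_spinLift (κ : {κ : Fin 2 → ℂ // κ ≠ 0}) : (spinLift κ).normal = spinorNormal κ :=
  spinorHorosphere_normal κ

theorem centre_spinLift (κ : {κ : Fin 2 → ℂ // κ ≠ 0}) : (spinLift κ).centre = ratio κ.1 := by
  rw [Horosphere.centre_eq, normal_spinLift, invHeight_eq_toHermitian, horizontal_eq_toHermitian,
    toHermitian_spinorNormal]
  by_cases h : κ.1 1 = 0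
  · simp [ratio, vecMulVec_apply, h]
  · have : conj (κ.1 1) ≠ 0 := star_ne_zero.mpr h
    simp [ratio, vecMulVec_apply, h]
    field_simp

theorem centre_spinLift_eq_iff (κ₁ κ₂ : {κ : Fin 2 → ℂ // κ ≠ 0}) :
    (spinLift κ₁).centre = (spinLift κ₂).centre ↔ bracket κ₁.1 κ₂.1 = 0 := by
  rw [centre_spinLift, centre_spinLift, ratio_eq_ratio_iff κ₁.2 κ₂.2]

theorem exists_wout_spinLift_eq {A : SL2C} {κ : {κ : Fin 2 → ℂ // κ ≠ 0}}
    (hA : ∀ r, A r 0 = κ.1 r) : ∃ q, (spinLift κ).wout q = A :=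
  (range_spinLift_wout κ).ge hA

theorem spinorNormal_smul (c : ℂ) (κ : Fin 2 → ℂ) :
    spinorNormal (c • κ) = Complex.normSq c • spinorNormal κ := by
  apply toHermitian_injective
  ext i j
  simp [toHermitian_smul, toHermitian_spinorNormal, vecMulVec_apply,
    Complex.normSq_eq_conj_mul_self]
  ring

theorem act_e0_eq (A : SL2C) : act A ![1, 0, 0, 0] =
    (1 / 2 : ℝ) • spinorNormal (fun r => A r 0) + (1 / 2 : ℝ) • spinorNormal (fun r => A r 1) := by
  apply toHermitian_injective
  rw [toHermitian_act, toHermitian_e0, toHermitian_add, toHermitian_smul, toHermitian_smul,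
    toHermitian_spinorNormal, toHermitian_spinorNormal]
  ext i j
  simp [Matrix.mul_apply, Fin.sum_univ_two, vecMulVec_apply]
  ring

theorem mul_rotMatrix_pi_mul_loxMatrix (A : SL2C) (d : ℂ) :
    ((A * rotMatrix Real.pi * loxMatrix d : SL2C) : Matrix (Fin 2) (Fin 2) ℂ) =
      !![Complex.exp (d / 2) * A 0 1, -(Complex.exp (d / 2))⁻¹ * A 0 0;
        Complex.exp (d / 2) * A 1 1, -(Complex.exp (d / 2))⁻¹ * A 1 0] := by
  rw [Matrix.SpecialLinearGroup.coe_mul, Matrix.SpecialLinearGroup.coe_mul]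
  ext i j
  fin_cases i <;> fin_cases j <;>
    simp [rotMatrix, loxMatrix, Matrix.mul_apply, Fin.sum_univ_two, neg_div, Complex.exp_neg,
      mul_comm]

theorem exp_half_eq_bracket {κ₁ κ₂ : {κ : Fin 2 → ℂ // κ ≠ 0}} {q₁ : (spinLift κ₁).carrier}
    {q₂ : (spinLift κ₂).carrier} {d : ℂ}
    (h : IsComplexDistance ((spinLift κ₁).win q₁) ((spinLift κ₂).wout q₂) d) :
    Complex.exp (d / 2) = bracket κ₁.1 κ₂.1 := by
  have columns : spinMatrix κ₂ q₂ = _ :=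
    (congrArg Subtype.val (isComplexDistance_iff.mp h)).trans
      (mul_rotMatrix_pi_mul_loxMatrix (spinSL κ₁ q₁) d)
  have det : κ₁.1 0 * spinSL κ₁ q₁ 1 1 - spinSL κ₁ q₁ 0 1 * κ₁.1 1 = 1 :=
    (det_fin_two _).symm.trans (spinSL κ₁ q₁).det_coe
  have κ₂0 : κ₂.1 0 = Complex.exp (d / 2) * spinSL κ₁ q₁ 0 1 := congrFun₂ columns 0 0
  have κ₂1 : κ₂.1 1 = Complex.exp (d / 2) * spinSL κ₁ q₁ 1 1 := congrFun₂ columns 1 0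
  rw [bracket, κ₂0, κ₂1]
  linear_combination -Complex.exp (d / 2) * det

theorem mem_geodesic_of_wout_apply_one {κ₁ κ₂ : {κ : Fin 2 → ℂ // κ ≠ 0}}
    {q : (spinLift κ₁).carrier} {c : ℂ} (hc : c ≠ 0)
    (h : ∀ r, (spinLift κ₁).wout q r 1 = c * κ₂.1 r) :
    (q : Minkowski) ∈ geodesic (spinLift κ₁).normal (spinLift κ₂).normal := by
  have pos : 0 < Complex.normSq c := Complex.normSq_pos.mpr hc
  have column_zero : (fun r => spinSL κ₁ q r 0) = κ₁.1 := by ext r; fin_cases r <;> rfl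
  have column_one : (fun r => spinSL κ₁ q r 1) = c • κ₂.1 := funext h
  refine ⟨q.2.1, 1 / 2, 1 / 2 * Complex.normSq c, by positivity, by positivity, ?_⟩
  rw [← act_spinSL κ₁ q, act_e0_eq, column_zero, column_one, spinorNormal_smul, smul_smul,
    normal_spinLift, normal_spinLift]

theorem geodesic_comm (p₁ p₂ : Minkowski) : geodesic p₁ p₂ = geodesic p₂ p₁ := by
  ext q
  constructor <;> rintro ⟨hq, a, b, ha, hb, rfl⟩ <;> exact ⟨hq, b, a, hb, ha, add_comm _ _⟩

theorem isLambdaLength_bracket {κ₁ κ₂ : {κ : Fin 2 → ℂ // κ ≠ 0}} (h : bracket κ₁.1 κ₂.1 ≠ 0) :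
    IsLambdaLength (spinLift κ₁) (spinLift κ₂) (bracket κ₁.1 κ₂.1) := by
  set D := bracket κ₁.1 κ₂.1 with hD
  have exp_log : Complex.exp (2 * Complex.log D / 2) = D := by
    rw [mul_div_cancel_left₀ _ two_ne_zero, Complex.exp_log h]
  -- The frames `A` and `B` lie over the points where the geodesic meets the two horospheres.
  let A : SL2C := ⟨!![κ₁.1 0, D⁻¹ * κ₂.1 0; κ₁.1 1, D⁻¹ * κ₂.1 1], by
    rw [det_fin_two_of]; field_simp; exact hD.symm⟩
  let B : SL2C := A * rotMatrix Real.pi * loxMatrix (2 * Complex.log D)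
  have hB : B.1 = !![κ₂.1 0, -D⁻¹ * κ₁.1 0; κ₂.1 1, -D⁻¹ * κ₁.1 1] := by
    simp only [B, mul_rotMatrix_pi_mul_loxMatrix, exp_log]
    simp [A, h]
  obtain ⟨q₁, hq₁⟩ : ∃ q, (spinLift κ₁).wout q = A :=
    exists_wout_spinLift_eq (Fin.forall_fin_two.mpr ⟨rfl, rfl⟩)
  obtain ⟨q₂, hq₂⟩ : ∃ q, (spinLift κ₂).wout q = B :=
    exists_wout_spinLift_eq (by rw [hB]; exact Fin.forall_fin_two.mpr ⟨rfl, rfl⟩)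
  refine .inr ⟨mt (centre_spinLift_eq_iff κ₁ κ₂).mp h, q₁, q₂, 2 * Complex.log D,
    mem_geodesic_of_wout_apply_one (inv_ne_zero h) ?_, ?_, isComplexDistance_iff.mpr ?_,
    exp_log.symm⟩
  · rw [hq₁]
    exact Fin.forall_fin_two.mpr ⟨rfl, rfl⟩
  · rw [geodesic_comm]
    refine mem_geodesic_of_wout_apply_one (neg_ne_zero.mpr (inv_ne_zero h)) ?_
    rw [hq₂, hB]
    exact Fin.forall_fin_two.mpr ⟨rfl, rfl⟩
  · rw [hq₂]
    change A * _ * _ = (spinLift κ₁).wout q₁ * _ * _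
    rw [hq₁]

theorem isLambdaLength_iff (κ₁ κ₂ : {κ : Fin 2 → ℂ // κ ≠ 0}) (l : ℂ) :
    IsLambdaLength (spinLift κ₁) (spinLift κ₂) l ↔ l = bracket κ₁.1 κ₂.1 := by
  have centres := centre_spinLift_eq_iff κ₁ κ₂
  constructor
  · rintro (⟨eq, rfl⟩ | ⟨-, q₁, q₂, d, -, -, distance, rfl⟩)
    · exact (centres.mp eq).symm
    · exact exp_half_eq_bracket distance
  · rintro rfl
    by_cases h : bracket κ₁.1 κ₂.1 = 0
    · exact .inl ⟨centres.mpr h, h⟩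
    · exact isLambdaLength_bracket h

/-! ### Bijectivity of the spinor–horosphere correspondence -/

theorem exists_wout_spinLift_mul_eq_zero (κ : {κ : Fin 2 → ℂ // κ ≠ 0}) :
    ∃ q, κ.1 1 * (spinLift κ).wout q 1 1 = 0 := by
  by_cases h : κ.1 1 = 0
  · have h0 := apply_zero_ne_zero κ.2 h
    obtain ⟨q, -⟩ := exists_wout_spinLift_eq (κ := κ)
      (A := ⟨!![κ.1 0, 0; κ.1 1, (κ.1 0)⁻¹], by rw [det_fin_two_of]; simp [h0]⟩)
      (Fin.forall_fin_two.mpr ⟨rfl, rfl⟩)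
    exact ⟨q, by rw [h, zero_mul]⟩
  · obtain ⟨q, hq⟩ := exists_wout_spinLift_eq (κ := κ)
      (A := ⟨!![κ.1 0, -(κ.1 1)⁻¹; κ.1 1, 0], by rw [det_fin_two_of]; simp [h]⟩)
      (Fin.forall_fin_two.mpr ⟨rfl, rfl⟩)
    exact ⟨q, by rw [hq]; exact mul_zero _⟩

theorem spinLift_injective : Function.Injective spinLift := by
  intro κ κ' h
  obtain ⟨q, -⟩ := exists_wout_spinLift_mul_eq_zero κ
  have mem : (spinLift κ).wout q ∈ Set.range (spinLift κ').wout := h ▸ Set.mem_range_self q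
  rw [range_spinLift_wout] at mem
  apply Subtype.ext
  funext r
  rw [← mem r]
  fin_cases r <;> rfl

theorem eq_spinSL {κ : Fin 2 → ℂ} {q : horosphereOf (spinorNormal κ)} {A : SL2C}
    (column : ∀ r, A r 0 = κ r) (pos : act A ![1, 0, 0, 0] = q) : A = spinSL κ q := by
  have hκ : A.1 *ᵥ ![1, 0] = κ := by
    ext r
    simp [Matrix.mulVec, dotProduct, column]
  apply Subtype.ext
  rw [← spinMatrix_of_SL A, hκ, pos]
  rfl

theorem convex_bracket_eq_one (κ : Fin 2 → ℂ) : Convex ℝ {v : Fin 2 → ℂ | bracket κ v = 1} := by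
  intro v hv w hw a b _ _ hab
  have hab' : (a : ℂ) + b = 1 := by exact_mod_cast hab
  simp only [bracket, Set.mem_ofPred_eq, Pi.add_apply, Pi.smul_apply, Complex.real_smul] at hv hw ⊢
  linear_combination a * hv + b * hw + hab'

theorem carrier_spinorHorosphere_eq_image (κ : {κ : Fin 2 → ℂ // κ ≠ 0}) :
    (spinorHorosphere κ).carrier =
      (fun v => (1 / 2 : ℝ) • spinorNormal κ.1 + (1 / 2 : ℝ) • spinorNormal v) ''
        {v | bracket κ.1 v = 1} := by
  ext x
  constructor
  · intro hx
    refine ⟨fun r => spinSL κ ⟨x, hx⟩ r 1,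
      (det_fin_two _).symm.trans (spinSL κ ⟨x, hx⟩).det_coe, ?_⟩
    have column_zero : (fun r => spinSL κ ⟨x, hx⟩ r 0) = κ.1 := by ext r; fin_cases r <;> rfl
    have pos := act_spinSL κ ⟨x, hx⟩
    rw [act_e0_eq, column_zero] at pos
    exact pos
  · rintro ⟨v, hv, rfl⟩
    let A : SL2C := ⟨!![κ.1 0, v 0; κ.1 1, v 1], by rw [det_fin_two_of]; exact hv⟩
    obtain ⟨q, hq⟩ : ∃ q, (spinLift κ).wout q = A :=
      exists_wout_spinLift_eq (Fin.forall_fin_two.mpr ⟨rfl, rfl⟩)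
    have columns : (fun r => A r 0) = κ.1 ∧ (fun r => A r 1) = v := by
      constructor <;> ext r <;> fin_cases r <;> rfl
    have pos : act ((spinLift κ).wout q) ![1, 0, 0, 0] = q := act_spinSL κ q
    rw [hq, act_e0_eq, columns.1, columns.2] at pos
    change _ + _ ∈ _
    rw [pos]
    exact q.2

theorem continuous_spinorNormal : Continuous spinorNormal := by
  unfold spinorNormal ofHermitian
  simp only [vecMulVec_apply, Pi.star_apply]
  fun_prop

theorem preconnectedSpace_spinorHorosphere (κ : {κ : Fin 2 → ℂ // κ ≠ 0}) :
    PreconnectedSpace (spinorHorosphere κ).carrier := by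
  rw [← isPreconnected_iff_preconnectedSpace, carrier_spinorHorosphere_eq_image]
  have := continuous_spinorNormal
  exact (convex_bracket_eq_one κ.1).isPreconnected.image _ (by fun_prop)

theorem exists_isParabolic_act_eq {κ : Fin 2 → ℂ} (q q' : horosphereOf (spinorNormal κ)) :
    ∃ P : SL2C, IsParabolic P ∧
      act P '' horosphereOf (spinorNormal κ) = horosphereOf (spinorNormal κ) ∧ q' = act P q := by
  -- This matrix fixes `κ`, hence is unipotent.
  refine ⟨spinSL κ q' * (spinSL κ q)⁻¹, .inl ?_, ?_, ?_⟩
  · have det := (det_fin_two _).symm.trans (spinSL κ q).det_coe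
    have det' := (det_fin_two _).symm.trans (spinSL κ q').det_coe
    rw [Matrix.SpecialLinearGroup.coe_mul, Matrix.SpecialLinearGroup.coe_inv, adjugate_fin_two,
      trace_fin_two]
    have columns (r : Fin 2) : (spinSL κ q).1 r 0 = (spinSL κ q').1 r 0 := by
      fin_cases r <;> rfl
    simp only [Matrix.mul_apply, Fin.sum_univ_two, of_apply, cons_val', cons_val_zero, cons_val_one,
      cons_val_fin_one, columns] at det ⊢
    linear_combination det + det'
  · rw [act_horosphere]
    congr
    calc _ = (spinSL κ q' * (spinSL κ q)⁻¹ * spinSL κ q).1 *ᵥ ![1, 0] := by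
          rw [Matrix.SpecialLinearGroup.coe_mul _ (spinSL κ q), ← mulVec_mulVec, spinSL_mulVec]
      _ = κ := by rw [inv_mul_cancel_right, spinSL_mulVec]
  · rw [← act_spinSL κ q, ← act_mul, inv_mul_cancel_right, act_spinSL]

theorem Horosphere.IsUnitParallel.eq_of_apply_eq {κ : {κ : Fin 2 → ℂ // κ ≠ 0}}
    {V V' : (spinorHorosphere κ).carrier → Minkowski} (hV : (spinorHorosphere κ).IsUnitParallel V)
    (hV' : (spinorHorosphere κ).IsUnitParallel V') {q : (spinorHorosphere κ).carrier}
    (h : V q = V' q) : V = V' := by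
  funext q'
  obtain ⟨P, parabolic, preserves, hq'⟩ := exists_isParabolic_act_eq q q'
  rw [hV.parallel P parabolic preserves q q' hq', h, hV'.parallel P parabolic preserves q q' hq']

theorem eq_spinLift_of_toHorosphere_eq {w : SpinDecoratedHorosphere}
    {κ : {κ : Fin 2 → ℂ // κ ≠ 0}} (h : w.toHorosphere = spinorHorosphere κ) {q : w.carrier}
    (column : ∀ r, w.wout q r 0 = κ.1 r) : spinLift κ = w := by
  obtain ⟨H, win, wout, _, continuous_wout, V, parallel, lifts_in, lifts_out, rotate, _⟩ := w
  obtain rfl : H = spinorHorosphere κ := h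
  have wout_q : wout q = spinSL κ q :=
    eq_spinSL column (congrArg Frame.pos (lifts_out q))
  have direction_eq : V = fun q => act (spinSL κ q) ![0, 0, 1, 0] := by
    refine parallel.eq_of_apply_eq (spinorHorosphere_isUnitParallel κ) (q := q) ?_
    rw [← wout_q]
    exact (congrArg Frame.v2 (lifts_out q)).symm
  have wout_eq : wout = spinSL κ := by
    have := preconnectedSpace_spinorHorosphere κ
    refine (eq_or_eq_neg_of_lifts continuous_wout (continuous_spinSL κ) fun q => ?_).resolve_right
      fun neg => ne_neg_self _ (wout_q.symm.trans (congrFun neg q))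
    rw [lifts_out, direction_eq]
    exact (spinProj_spinSL κ q).symm
  have win_eq : win = fun q => spinSL κ q * rotMatrix Real.pi := by
    funext q
    rw [← wout_eq]
    exact (rotate q).unique (spinRotateSecond_mul _ _)
  subst wout_eq win_eq
  rfl

theorem horosphereOf_nonempty {p : Minkowski} (hp : p ∈ lightCone) :
    (horosphereOf p).Nonempty := by
  obtain ⟨pos, null⟩ := hp
  refine ⟨(1 / 2 : ℝ) • p + (1 / (2 * p 0 ^ 2)) • ![p 0, -p 1, -p 2, -p 3], ⟨?_, ?_⟩, ?_⟩
  · change 0 < 1 / 2 * p 0 + 1 / (2 * p 0 ^ 2) * p 0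
    positivity
  all_goals
    simp only [minkInner, Pi.add_apply, Pi.smul_apply, smul_eq_mul, cons_val] at null ⊢
    field_simp
  · linear_combination (p 0 ^ 2 - 1) ^ 2 * null
  · linear_combination (p 0 ^ 2 - 1) * null

theorem Horosphere.normal_mem (h : Horosphere) : h.normal ∈ lightCone :=
  h.exists_normal.choose_spec.1

theorem Horosphere.carrier_eq (h : Horosphere) : h.carrier = horosphereOf h.normal :=
  h.exists_normal.choose_spec.2

theorem Horosphere.ext_normal {h h' : Horosphere} (eq : h.normal = h'.normal) : h = h' := by
  have carriers : h.carrier = h'.carrier := by rw [h.carrier_eq, h'.carrier_eq, eq]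
  cases h
  cases h'
  congr

theorem spinLift_surjective : Function.Surjective spinLift := by
  intro w
  obtain ⟨q, hq⟩ : w.carrier.Nonempty := by
    rw [w.carrier_eq]
    exact horosphereOf_nonempty w.normal_mem
  obtain ⟨A, hA⟩ : ∃ A, w.wout ⟨q, hq⟩ = A := ⟨_, rfl⟩
  obtain ⟨V, -, -, lifts, -⟩ := w.associated
  have act_e0 : act A ![1, 0, 0, 0] = q := hA ▸ congrArg Frame.pos (lifts ⟨q, hq⟩)
  have act_e3 : act A ![0, 0, 0, 1] = w.normal - q :=
    hA ▸ congrArg Frame.v1 (lifts ⟨q, hq⟩)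
  have first_column : A.1 *ᵥ ![1, 0] = fun r => A r 0 := by
    ext r
    simp [Matrix.mulVec, dotProduct]
  have e0_add_e3 : (![1, 0, 0, 1] : Minkowski) = ![1, 0, 0, 0] + ![0, 0, 0, 1] := by simp
  have normal_eq : spinorNormal (fun r => A r 0) = w.normal := by
    rw [← first_column, ← act_spinorNormal, spinorNormal_one_zero, e0_add_e3, act_add, act_e0,
      act_e3, add_sub_cancel]
  have column_ne_zero : (fun r => A r 0) ≠ 0 := fun h =>
    one_ne_zero (A.det_coe.symm.trans (det_eq_zero_of_column_eq_zero 0 (congrFun h)))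
  have horosphere_eq : w.toHorosphere = spinorHorosphere ⟨_, column_ne_zero⟩ :=
    Horosphere.ext_normal (normal_eq.symm.trans (spinorHorosphere_normal ⟨_, column_ne_zero⟩).symm)
  exact ⟨_, eq_spinLift_of_toHorosphere_eq horosphere_eq (q := ⟨q, hq⟩) fun r => by rw [hA]⟩

/-! ### Planar spin decorations -/

theorem toUpper_eq (x : Minkowski) :
    toUpper x = (invHeight x)⁻¹ • (horizontal x, (1 : ℝ)) := by
  ext1
  · simp [toUpper, invHeight_apply, horizontal_apply, div_eq_inv_mul, mul_add]
  · simp [toUpper, invHeight_apply]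

theorem fderiv_toUpper_apply {x : Minkowski} (hx : invHeight x ≠ 0) (v : Minkowski) :
    fderiv ℝ toUpper x v =
      (invHeight x)⁻¹ • (horizontal v, (0 : ℝ)) -
        (invHeight v / invHeight x ^ 2) • (horizontal x, (1 : ℝ)) := by
  have inv := (hasDerivAt_inv hx).comp_hasFDerivAt x invHeight.hasFDerivAt
  have pair := horizontal.hasFDerivAt (x := x) |>.prodMk (hasFDerivAt_const (1 : ℝ) x)
  have product : HasFDerivAt (fun y => (invHeight y)⁻¹ • (horizontal y, (1 : ℝ))) _ x :=
    inv.smul pair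
  rw [funext toUpper_eq, product.fderiv]
  ext1 <;> simp <;> ring

theorem invHeight_pos {q : Minkowski} (hq : q ∈ hyperboloid) : 0 < invHeight q := by
  obtain ⟨pos, unit⟩ := hq
  rw [minkInner] at unit
  rw [invHeight_apply]
  nlinarith [sq_nonneg (q 1), sq_nonneg (q 2)]

theorem Horosphere.invHeight_pos (h : Horosphere) (q : h.carrier) : 0 < invHeight (q : Minkowski) :=
  SpinHyp.invHeight_pos (h.carrier_eq ▸ q.2 : (q : Minkowski) ∈ horosphereOf h.normal).1

theorem Horosphere.isSpecifiedBy_iff {h : Horosphere} {V : h.carrier → Minkowski} {α : ℂ} :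
    h.IsSpecifiedBy V α ↔ ∀ q : h.carrier,
      (∀ q' : h.carrier, invHeight (q : Minkowski) ≤ invHeight (q' : Minkowski)) →
        invHeight (V q) = 0 ∧ ∃ c : ℝ, 0 < c ∧ horizontal (V q) = c * α := by
  refine forall_congr' fun q => imp_congr (forall_congr' fun q' => ?_) ?_
  · exact one_div_le_one_div (h.invHeight_pos q') (h.invHeight_pos q)
  have pos := h.invHeight_pos q
  rw [fderiv_toUpper_apply pos.ne']
  generalize invHeight (q : Minkowski) = s at pos
  have s_ne_zero : (s : ℂ) ≠ 0 := mod_cast pos.ne'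
  have level : (s⁻¹ • (horizontal (V q), (0 : ℝ)) - (invHeight (V q) / s ^ 2) •
      (horizontal (q : Minkowski), (1 : ℝ))).2 = 0 ↔ invHeight (V q) = 0 := by simp [pos.ne']
  constructor
  · rintro ⟨c, hc, eq⟩
    have zero := level.mp (congrArg Prod.snd eq)
    refine ⟨zero, s * c, by positivity, ?_⟩
    have fst := congrArg Prod.fst eq
    simp only [zero, zero_div, zero_smul, sub_zero, Prod.smul_mk, Complex.real_smul,
      Complex.ofReal_inv] at fst
    rw [inv_mul_eq_iff_eq_mul₀ s_ne_zero] at fst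
    rw [fst, Complex.ofReal_mul, mul_assoc]
  · rintro ⟨zero, c, hc, eq⟩
    refine ⟨s⁻¹ * c, by positivity, Prod.ext ?_ (level.mpr zero)⟩
    simp [zero, eq, mul_assoc]

theorem wout_spinLift_det (κ : {κ : Fin 2 → ℂ // κ ≠ 0}) (q : (spinLift κ).carrier) :
    κ.1 0 * (spinLift κ).wout q 1 1 - (spinLift κ).wout q 0 1 * κ.1 1 = 1 :=
  (det_fin_two _).symm.trans ((spinLift κ).wout q).det_coe

theorem invHeight_spinorNormal (κ : Fin 2 → ℂ) :
    invHeight (spinorNormal κ) = 2 * Complex.normSq (κ 1) := by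
  have h := invHeight_eq_toHermitian (spinorNormal κ)
  rw [toHermitian_spinorNormal, vecMulVec_apply, Pi.star_apply, Complex.star_def,
    Complex.mul_conj] at h
  exact_mod_cast h

theorem invHeight_eq_add_normSq (κ : {κ : Fin 2 → ℂ // κ ≠ 0}) (q : (spinLift κ).carrier) :
    invHeight (q : Minkowski) =
      Complex.normSq (κ.1 1) + Complex.normSq ((spinLift κ).wout q 1 1) := by
  rw [← act_spinSL κ q, act_e0_eq, map_add, _root_.map_smul, _root_.map_smul,
    invHeight_spinorNormal, invHeight_spinorNormal, smul_eq_mul, smul_eq_mul, one_div,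
    inv_mul_cancel_left₀ two_ne_zero, inv_mul_cancel_left₀ two_ne_zero]
  rfl

-- The product accounts for both cases: all points are highest when `κ 1 = 0`.
theorem forall_invHeight_le_iff {κ : {κ : Fin 2 → ℂ // κ ≠ 0}} {q : (spinLift κ).carrier} :
    (∀ q' : (spinLift κ).carrier, invHeight (q : Minkowski) ≤ invHeight (q' : Minkowski)) ↔
      κ.1 1 * (spinLift κ).wout q 1 1 = 0 := by
  simp only [invHeight_eq_add_normSq, add_le_add_iff_left]
  by_cases h : κ.1 1 = 0
  · have entry (q') : (spinLift κ).wout q' 1 1 = (κ.1 0)⁻¹ := by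
      have := wout_spinLift_det κ q'
      rw [h, mul_zero, sub_zero] at this
      exact eq_inv_of_mul_eq_one_right this
    simp [entry, h]
  · rw [mul_eq_zero, or_iff_right h]
    constructor
    · intro highest
      obtain ⟨q', hq'⟩ := exists_wout_spinLift_mul_eq_zero κ
      have le := highest q'
      rw [(mul_eq_zero.mp hq').resolve_left h, Complex.normSq_zero] at le
      exact Complex.normSq_eq_zero.mp (le.antisymm (Complex.normSq_nonneg _))
    · intro zero q'
      rw [zero, Complex.normSq_zero]
      exact Complex.normSq_nonneg _

theorem toHermitian_direction_apply_one (κ : {κ : Fin 2 → ℂ // κ ≠ 0})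
    (q : (spinLift κ).carrier) (r : Fin 2) :
    2 * toHermitian ((spinLift κ).direction q) r 1 =
      (κ.1 r * conj ((spinLift κ).wout q 1 1) - (spinLift κ).wout q r 1 * conj (κ.1 1)) *
        Complex.I := by
  have column (r : Fin 2) : (spinLift κ).wout q r 0 = κ.1 r := by fin_cases r <;> rfl
  rw [SpinDecoratedHorosphere.direction, spinProj, toHermitian_act]
  simp [toHermitian, Matrix.mul_apply, Fin.sum_univ_two, column]
  ring

theorem invHeight_direction_eq_zero {κ : {κ : Fin 2 → ℂ // κ ≠ 0}} {q : (spinLift κ).carrier}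
    (highest : κ.1 1 * (spinLift κ).wout q 1 1 = 0) :
    invHeight ((spinLift κ).direction q) = 0 := by
  rw [← Complex.ofReal_eq_zero, invHeight_eq_toHermitian, toHermitian_direction_apply_one]
  rcases mul_eq_zero.mp highest with h | h <;> simp [h]

theorem horizontal_direction {κ : {κ : Fin 2 → ℂ // κ ≠ 0}} {q : (spinLift κ).carrier}
    (highest : κ.1 1 * (spinLift κ).wout q 1 1 = 0) :
    horizontal ((spinLift κ).direction q) =
      (if κ.1 1 = 0 then κ.1 0 / conj (κ.1 0) else conj (κ.1 1) / κ.1 1) * Complex.I := by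
  rw [horizontal_eq_toHermitian, toHermitian_direction_apply_one]
  have det := wout_spinLift_det κ q
  congr 1
  split_ifs with h
  · rw [h, mul_zero, sub_zero] at det
    simp [h, eq_inv_of_mul_eq_one_right det, div_eq_mul_inv]
  · rw [(mul_eq_zero.mp highest).resolve_left h] at det ⊢
    rw [map_zero, eq_div_iff h]
    linear_combination conj (κ.1 1) * det

theorem exists_pos_div_conj_eq_iff {z : ℂ} (hz : z ≠ 0) :
    (∃ c : ℝ, 0 < c ∧ z / conj z = c) ↔ conj z = z := by
  have hz' : conj z ≠ 0 := star_ne_zero.mpr hz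
  constructor
  · rintro ⟨c, hc, h⟩
    have norm := congrArg norm h
    rw [norm_div, Complex.norm_conj, div_self (norm_ne_zero_iff.mpr hz), Complex.norm_real,
      Real.norm_of_nonneg hc.le] at norm
    rw [← norm, Complex.ofReal_one, div_eq_one_iff_eq hz'] at h
    exact h.symm
  · intro h
    exact ⟨1, one_pos, by rw [h, div_self hz, Complex.ofReal_one]⟩

theorem isSpecifiedBy_spinLift_iff {κ : {κ : Fin 2 → ℂ // κ ≠ 0}} :
    (spinLift κ).IsSpecifiedBy (spinLift κ).direction Complex.I ↔
      conj (κ.1 1) = κ.1 1 ∧ (κ.1 1 = 0 → conj (κ.1 0) = κ.1 0) := by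
  rw [Horosphere.isSpecifiedBy_iff]
  have specified_iff (q : (spinLift κ).carrier) (hq : κ.1 1 * (spinLift κ).wout q 1 1 = 0) :
      (invHeight ((spinLift κ).direction q) = 0 ∧
        ∃ c : ℝ, 0 < c ∧ horizontal ((spinLift κ).direction q) = c * Complex.I) ↔
      conj (κ.1 1) = κ.1 1 ∧ (κ.1 1 = 0 → conj (κ.1 0) = κ.1 0) := by
    simp only [invHeight_direction_eq_zero hq, horizontal_direction hq, true_and,
      mul_left_inj' Complex.I_ne_zero]
    by_cases h : κ.1 1 = 0
    · simp [h, exists_pos_div_conj_eq_iff (apply_zero_ne_zero κ.2 h)]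
    · have key := exists_pos_div_conj_eq_iff (star_ne_zero.mpr h)
      simp only [Complex.star_def, Complex.conj_conj] at key
      simp only [h, if_false, key, false_imp_iff, and_true, eq_comm (a := κ.1 1)]
  obtain ⟨q₀, hq₀⟩ := exists_wout_spinLift_mul_eq_zero κ
  exact ⟨
    fun specified => (specified_iff q₀ hq₀).mp (specified q₀ (forall_invHeight_le_iff.mpr hq₀)),
    fun real q highest => (specified_iff q (forall_invHeight_le_iff.mp highest)).mpr real⟩

theorem spinLift_isPlanarAt_iff {κ : {κ : Fin 2 → ℂ // κ ≠ 0}} {z : OnePoint ℝ} :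
    (spinLift κ).IsPlanarAt z ↔ ∃ v : Fin 2 → ℝ, κ.1 = Complex.ofReal ∘ v ∧ z = ratio v := by
  rw [SpinDecoratedHorosphere.IsPlanarAt, isSpecifiedBy_spinLift_iff, centre_spinLift]
  have map_injective : Function.Injective (OnePoint.map Complex.ofReal) :=
    Option.map_injective Complex.ofReal_injective
  constructor
  · rintro ⟨centre, real_one, real_zero⟩
    have real_zero' : conj (κ.1 0) = κ.1 0 := by
      by_cases h : κ.1 1 = 0
      · exact real_zero h
      · rw [ratio_of_ne_zero h] at centre
        induction z with
        | infty => exact absurd centre (OnePoint.coe_ne_infty _)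
        | coe x =>
          rw [OnePoint.map_some, OnePoint.coe_eq_coe, div_eq_iff h] at centre
          rw [centre, map_mul, real_one, Complex.conj_ofReal]
    obtain ⟨v, hv⟩ : ∃ v : Fin 2 → ℝ, κ.1 = Complex.ofReal ∘ v := by
      refine ⟨fun r => (κ.1 r).re, funext fun r => (Complex.conj_eq_iff_re.mp ?_).symm⟩
      fin_cases r
      exacts [real_zero', real_one]
    refine ⟨v, hv, map_injective ?_⟩
    rw [← centre, hv]
    exact ratio_map Complex.ofRealHom v
  · rintro ⟨v, hv, rfl⟩
    rw [hv]
    exact ⟨ratio_map Complex.ofRealHom v, Complex.conj_ofReal _, fun _ => Complex.conj_ofReal _⟩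

/-! ### Rank and cyclic order -/

theorem rank_eq_two_iff {K n : Type*} [Field K] [Fintype n] (M : Matrix (Fin 2) n K) :
    M.rank = 2 ↔ ∃ i j, bracket (M.col i) (M.col j) ≠ 0 := by
  have rows : M.rank = 2 ↔ LinearIndependent K ![M.row 0, M.row 1] := by
    have row_eq : M.row = ![M.row 0, M.row 1] := by ext i; fin_cases i <;> rfl
    rw [rank_eq_finrank_span_row, ← row_eq, linearIndependent_iff_card_eq_finrank_span,
      Fintype.card_fin, eq_comm, Set.finrank]
  rw [rows, LinearIndependent.pair_iff]
  constructor
  · intro independent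
    by_contra! zero
    have zero' (i j : n) : M 0 i * M 1 j - M 0 j * M 1 i = 0 := zero i j
    have entries (i : n) : M 1 i = 0 ∧ -M 0 i = 0 := independent _ _ <| funext fun j => by
      change M 1 i * M 0 j + -M 0 i * M 1 j = 0
      linear_combination -zero' i j
    have row_zero : M.row 0 = 0 := funext fun i => neg_eq_zero.mp (entries i).2
    exact one_ne_zero (independent 1 0 (by simp [row_zero])).1
  · rintro ⟨i, j, h⟩ s t relation
    have hi : s * M 0 i + t * M 1 i = 0 := congrFun relation i
    have hj : s * M 0 j + t * M 1 j = 0 := congrFun relation j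
    constructor <;> refine (mul_eq_zero.mp ?_).resolve_right h
    · change s * (M 0 i * M 1 j - M 0 j * M 1 i) = 0
      linear_combination M 1 j * hi - M 1 i * hj
    · change t * (M 0 i * M 1 j - M 0 j * M 1 i) = 0
      linear_combination M 0 i * hj - M 0 j * hi

/-- The vectors of the upper half plane together with the positive horizontal ray: a set of
representatives, up to positive scaling, of the real projective line. -/
def IsUpper (v : Fin 2 → ℝ) : Prop := 0 < v 1 ∨ v 1 = 0 ∧ 0 < v 0

theorem exists_isUpper_smul {v : Fin 2 → ℝ} (hv : v ≠ 0) : ∃ a : ℝ, a ≠ 0 ∧ IsUpper (a • v) := by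
  by_cases h : v 1 = 0
  · have h0 := apply_zero_ne_zero hv h
    exact ⟨v 0, h0, .inr ⟨mul_eq_zero_of_right _ h, mul_self_pos.mpr h0⟩⟩
  · exact ⟨v 1, h, .inl (mul_self_pos.mpr h)⟩

theorem IsUpper.cut_ratio_lt_iff {v w : Fin 2 → ℝ} (hv : IsUpper v) (hw : IsUpper w) :
    cut (ratio w) < cut (ratio v) ↔ 0 < bracket v w := by
  have cut_infty : cut ∞ = ⊤ := rfl
  have cut_coe (x : ℝ) : cut x = x := rfl
  rw [bracket, sub_pos]
  rcases hv with hv | ⟨hv, hv0⟩ <;> rcases hw with hw | ⟨hw, hw0⟩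
  · rw [ratio_of_ne_zero hv.ne', ratio_of_ne_zero hw.ne', cut_coe, cut_coe, WithTop.coe_lt_coe,
      div_lt_div_iff₀ hw hv]
  · simp [ratio_of_eq_zero hw, cut_infty, hw, (mul_pos hw0 hv).le]
  · simp [ratio_of_eq_zero hv, ratio_of_ne_zero hw.ne', cut_infty, cut_coe, hv, mul_pos hv0 hw]
  · simp [ratio_of_eq_zero hv, ratio_of_eq_zero hw, hv, hw]

theorem IsUpper.lt_cut_ratio_iff {v w : Fin 2 → ℝ} (hv : IsUpper v) (hw : IsUpper w) :
    cut (ratio v) < cut (ratio w) ↔ bracket v w < 0 := by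
  rw [hw.cut_ratio_lt_iff hv, bracket_swap, neg_pos]

theorem cut_ratio_cyclic {u v w : Fin 2 → ℝ} (hu : u ≠ 0) (hv : v ≠ 0) (hw : w ≠ 0)
    (h : 0 < bracket u v * (bracket v w * bracket u w)) :
    (cut (ratio u) > cut (ratio v) ∧ cut (ratio v) > cut (ratio w)) ∨
    (cut (ratio v) > cut (ratio w) ∧ cut (ratio w) > cut (ratio u)) ∨
    (cut (ratio w) > cut (ratio u) ∧ cut (ratio u) > cut (ratio v)) := by
  -- The product of the three brackets is even in each vector, so all of them may be made upper.
  obtain ⟨a, ha, upper_u⟩ := exists_isUpper_smul hu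
  obtain ⟨b, hb, upper_v⟩ := exists_isUpper_smul hv
  obtain ⟨c, hc, upper_w⟩ := exists_isUpper_smul hw
  have scaled : 0 < bracket (a • u) (b • v) * (bracket (b • v) (c • w) * bracket (a • u) (c • w)) :=
    calc 0 < (a * b * c) ^ 2 * (bracket u v * (bracket v w * bracket u w)) := by positivity
      _ = _ := by simp only [bracket_smul_smul]; ring
  rw [← ratio_smul ha u, ← ratio_smul hb v, ← ratio_smul hc w]
  simp only [gt_iff_lt]
  rw [mul_pos_iff, mul_pos_iff, mul_neg_iff, ← upper_u.cut_ratio_lt_iff upper_v,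
    ← upper_v.cut_ratio_lt_iff upper_w, ← upper_u.cut_ratio_lt_iff upper_w,
    ← upper_u.lt_cut_ratio_iff upper_v, ← upper_v.lt_cut_ratio_iff upper_w,
    ← upper_u.lt_cut_ratio_iff upper_w] at scaled
  rcases scaled with ⟨uv, ⟨vw, -⟩ | ⟨-, uw⟩⟩ | ⟨vu, ⟨vw, wu⟩ | ⟨wv, uw⟩⟩
  · exact .inl ⟨uv, vw⟩
  · exact .inr (.inr ⟨uw, uv⟩)
  · exact .inr (.inl ⟨vw, wu⟩)
  · exact absurd (uw.trans (vu.trans wv)) (lt_irrefl _)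

theorem injective_ratio_of_bracket_pos {ι K : Type*} [LinearOrder ι] [Field K] [Preorder K]
    {v : ι → Fin 2 → K} (hv : ∀ i, v i ≠ 0) (pos : ∀ i j, i < j → 0 < bracket (v i) (v j)) :
    Function.Injective fun i => ratio (v i) :=
  .of_lt_imp_ne fun i j hij h => (pos i j hij).ne' ((ratio_eq_ratio_iff (hv i) (hv j)).mp h)

theorem inOrder_ratio_of_bracket_pos {d : ℕ} {v : Fin d → Fin 2 → ℝ} (hv : ∀ i, v i ≠ 0)
    (pos : ∀ i j, i < j → 0 < bracket (v i) (v j)) : InOrder fun i => ratio (v i) :=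
  ⟨injective_ratio_of_bracket_pos hv pos, fun i j k hij hjk => cut_ratio_cyclic (hv i) (hv j) (hv k)
    (mul_pos (pos i j hij) (mul_pos (pos j k hjk) (pos i k (hij.trans hjk))))⟩

/-! ### Polygons -/

/-- The nonzero real vector `v`, regarded as a nonzero spinor. -/
noncomputable def realSpinor (v : {v : Fin 2 → ℝ // v ≠ 0}) : {κ : Fin 2 → ℂ // κ ≠ 0} :=
  ⟨Complex.ofReal ∘ v.1, fun h => v.2 (funext fun r => Complex.ofReal_eq_zero.mp (congrFun h r))⟩

theorem realSpinor_injective : Function.Injective realSpinor := fun _ _ h =>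
  Subtype.ext (Complex.ofReal_injective.comp_left (congrArg Subtype.val h))

theorem isLambdaLength_spinLift_realSpinor_iff (v w : {v : Fin 2 → ℝ // v ≠ 0}) (l : ℝ) :
    IsLambdaLength (spinLift (realSpinor v)) (spinLift (realSpinor w)) l ↔
      l = bracket v.1 w.1 := by
  rw [isLambdaLength_iff]
  exact (congrArg _ (bracket_map Complex.ofRealHom v.1 w.1)).to_iff.trans Complex.ofReal_inj

namespace DecoratedPolygon

variable {d : ℕ}

/-- The generalised ideal polygon with planar spin decorations whose spin vectors are `v`. -/
noncomputable def ofSpinVectors (v : Fin d → {v : Fin 2 → ℝ // v ≠ 0}) : DecoratedPolygon d where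
  vertex i := ratio (v i).1
  dec i := spinLift (realSpinor (v i))
  planar i := spinLift_isPlanarAt_iff.mpr ⟨(v i).1, rfl, rfl⟩

theorem ofSpinVectors_bijective : Function.Bijective (ofSpinVectors (d := d)) := by
  constructor
  · intro v w h
    exact funext fun i => realSpinor_injective <| spinLift_injective <|
      congrFun (congrArg dec h) i
  · rintro ⟨vertex, dec, planar⟩
    choose κ hκ using fun i => spinLift_surjective (dec i)
    obtain rfl : (fun i => spinLift (κ i)) = dec := funext hκ
    choose v hv hvertex using fun i => spinLift_isPlanarAt_iff.mp (planar i)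
    obtain rfl : vertex = fun i => ratio (v i) := funext hvertex
    have ne_zero (i : Fin d) : v i ≠ 0 := by
      intro zero
      exact (κ i).2 (by rw [hv, zero]; rfl)
    obtain rfl : κ = fun i => realSpinor ⟨v i, ne_zero i⟩ := funext fun i => Subtype.ext (hv i)
    exact ⟨fun i => ⟨v i, ne_zero i⟩, rfl⟩

/-- The correspondence between generalised ideal polygons with planar spin decorations and tuples
of nonzero real vectors. -/
noncomputable def spinVectors : DecoratedPolygon d ≃ (Fin d → {v : Fin 2 → ℝ // v ≠ 0}) :=
  (Equiv.ofBijective ofSpinVectors ofSpinVectors_bijective).symm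

/-- The matrix whose columns are the spin vectors of the polygon. -/
noncomputable def toMatrix (P : DecoratedPolygon d) : Matrix (Fin 2) (Fin d) ℝ :=
  of fun r i => (spinVectors P i).1 r

variable (P : DecoratedPolygon d)

theorem ofSpinVectors_spinVectors : ofSpinVectors (spinVectors P) = P :=
  spinVectors.symm_apply_apply P

theorem vertex_eq (i : Fin d) : P.vertex i = ratio (P.toMatrix.col i) :=
  congrFun (congrArg vertex P.ofSpinVectors_spinVectors.symm) i

theorem dec_eq (i : Fin d) : P.dec i = spinLift (realSpinor (spinVectors P i)) :=
  congrFun (congrArg dec P.ofSpinVectors_spinVectors.symm) i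

theorem col_toMatrix_ne_zero (i : Fin d) : P.toMatrix.col i ≠ 0 := (spinVectors P i).2

theorem isSpinVectorOf_dec_iff (i : Fin d) (κ : Fin 2 → ℂ) :
    IsSpinVectorOf κ (P.dec i) ↔ κ = fun r => (P.toMatrix r i : ℂ) := by
  rw [dec_eq]
  constructor
  · rintro ⟨_, h⟩
    exact congrArg Subtype.val (spinLift_injective h)
  · rintro rfl
    exact ⟨_, rfl⟩

theorem toMatrix_bijOn :
    Set.BijOn (toMatrix (d := d)) Set.univ {M | ∀ j, (fun r => M r j) ≠ 0} := by
  refine ⟨fun P _ => P.col_toMatrix_ne_zero, fun P _ Q _ h => spinVectors.injective ?_,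
    fun M hM => ⟨ofSpinVectors fun i => ⟨M.col i, hM i⟩, trivial, ?_⟩⟩
  · exact funext fun i => Subtype.ext (congrArg (col · i) h)
  · change of (fun r i => (spinVectors (spinVectors.symm fun i => ⟨M.col i, hM i⟩) i).1 r) = M
    rw [spinVectors.apply_symm_apply]
    rfl

theorem toMatrix_bijOn_of_mem_iff {S : Set (DecoratedPolygon d)}
    {T : Set (Matrix (Fin 2) (Fin d) ℝ)} (hT : T ⊆ {M | ∀ j, (fun r => M r j) ≠ 0})
    (h : ∀ P, P ∈ S ↔ P.toMatrix ∈ T) : Set.BijOn toMatrix S T := by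
  have preimage : S = Set.univ ∩ toMatrix ⁻¹' T := by
    ext P
    simpa using h P
  rw [preimage]
  exact toMatrix_bijOn.subset_right hT

theorem isDegenerate_iff_rank_ne_two : P.IsDegenerate ↔ P.toMatrix.rank ≠ 2 := by
  simp only [IsDegenerate, vertex_eq, ne_eq, rank_eq_two_iff, not_exists, not_not,
    ratio_eq_ratio_iff (P.col_toMatrix_ne_zero _) (P.col_toMatrix_ne_zero _)]

theorem isLambdaLength_dec_iff (i j : Fin d) (l : ℝ) :
    IsLambdaLength (P.dec i) (P.dec j) l ↔ l = bracket (P.toMatrix.col i) (P.toMatrix.col j) := by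
  rw [dec_eq, dec_eq]
  exact isLambdaLength_spinLift_realSpinor_iff _ _ l

theorem isIdealPolygon_and_isSpinCoherent_iff : P.IsIdealPolygon ∧ P.IsSpinCoherent ↔
    ∀ i j, i < j → 0 < bracket (P.toMatrix.col i) (P.toMatrix.col j) := by
  have vertex : P.vertex = fun i => ratio (P.toMatrix.col i) := funext P.vertex_eq
  simp only [IsIdealPolygon, IsSpinCoherent, isLambdaLength_dec_iff, exists_eq_right]
  constructor
  · rintro ⟨-, -, coherent⟩ i j
    exact (coherent i j).1
  · intro pos
    have inOrder : InOrder P.vertex := by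
      rw [vertex]
      exact inOrder_ratio_of_bracket_pos P.col_toMatrix_ne_zero pos
    refine ⟨inOrder, inOrder.1, fun i j => ⟨pos i j, fun hji => ?_⟩⟩
    rw [bracket_swap, neg_lt_zero]
    exact pos j i hji

end DecoratedPolygon

end SpinHyp

/-- The correspondence `Φ` takes the columns of the matrix to be the spinors corresponding to the
planar spin decorations, which are real. It restricts to bijections from all generalised ideal
`d`-gons with planar spin decorations onto the `2 × d` real matrices without zero columns, from the
nondegenerate ones onto those of rank 2, and from the spin-coherent ideal `d`-gons onto the matrices
all of whose `2 × 2` minors are positive. -/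
theorem mainTheorem12 (d : ℕ) :
    ∃ Φ : SpinHyp.DecoratedPolygon d → Matrix (Fin 2) (Fin d) ℝ,
      (∀ (P : SpinHyp.DecoratedPolygon d) (i : Fin d) (κ : Fin 2 → ℂ),
        SpinHyp.IsSpinVectorOf κ (P.dec i) ↔ κ = fun r => ((Φ P r i : ℝ) : ℂ)) ∧
      Set.BijOn Φ Set.univ {M | ∀ j, (fun r => M r j) ≠ 0} ∧
      Set.BijOn Φ {P | ¬ P.IsDegenerate} {M | (∀ j, (fun r => M r j) ≠ 0) ∧ M.rank = 2} ∧
      (2 ≤ d → Set.BijOn Φ {P | P.IsIdealPolygon ∧ P.IsSpinCoherent}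
        {M | ∀ i j, i < j → 0 < (M.submatrix id ![i, j]).det}) := by
  refine ⟨fun P => P.toMatrix, fun P => P.isSpinVectorOf_dec_iff,
    SpinHyp.DecoratedPolygon.toMatrix_bijOn, ?_, fun hd => ?_⟩
  · refine SpinHyp.DecoratedPolygon.toMatrix_bijOn_of_mem_iff (fun M hM => hM.1) fun P => ?_
    change ¬ P.IsDegenerate ↔ (∀ j, P.toMatrix.col j ≠ 0) ∧ P.toMatrix.rank = 2
    rw [P.isDegenerate_iff_rank_ne_two, not_ne_iff, and_iff_right P.col_toMatrix_ne_zero]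
  · have : Nontrivial (Fin d) := Fin.nontrivial_iff_two_le.mpr hd
    simp only [SpinHyp.det_submatrix_pair]
    exact SpinHyp.DecoratedPolygon.toMatrix_bijOn_of_mem_iff
      (fun M (pos : ∀ i j, i < j → 0 < SpinHyp.bracket (M.col i) (M.col j)) =>
        SpinHyp.ne_zero_of_bracket_pos pos)
      fun P => P.isIdealPolygon_and_isSpinCoherent_iff
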